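/- Let $K\subset\mathbb R^2$ be a nonempty compact convex set with support function $p(\varphi)=\sup\{\langle x,N(\varphi)\rangle : x\in K\}$, $N(\varphi)=(\cos\varphi,\sin\varphi)$. Assume that $K$ is strictly convex with boundary $\Gamma=\partial K$ of class $C^2$, in the sense that $p$ is of class $C^2$ and the radius of curvature $p(\varphi)+p''(\varphi)$ is positive for every $\varphi$. Let $L$ be the length of $\Gamma$, $F$ the area of $K$ and $\Delta=L^2-4\pi F$ the isoperimetric deficit. For a $2\pi$-periodic $C^1$ function $f$, the area with multiplicities of the envelope of the lines $x\cos t+y\sin t=f(t)$, $0\le t\le 2\pi$, is $\frac12\int_0^{2\pi}(f^2-f'^2)\,dt$ (which equals $\frac12\int_0^{2\pi} f(f+f'')\,dt$ when $f$ is $C^2$). Let $F_e$ be the area with multiplicities enclosed by the evolute of $\Gamma$, the envelope of the normal lines of $\Gamma$, for which $f(t)=\langle\gamma(t-\pi/2),N(t)\rangle=p'(t-\pi/2)$, where $\gamma(\varphi)=p(\varphi)N(\varphi)+p'(\varphi)N'(\varphi)$ parametrizes $\Gamma$. For $P\notin K$ let $\omega=\omega(P)$ be the visual angle of $\Gamma$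 from $P$, that is, the angle $\angle APB$, where $A,B\in\Gamma$ are the points of contact of the two tangents from $P$ to $\Gamma$, and let $dP$ be the area measure. Then $\omega-\sin\omega-\frac23\sin^3\omega$ is integrable over $\mathbb R^2\setminus K$ and $$\pi|F_e|-\Delta\ \ge\ \frac54L^2+5\int_{P\notin K}\Bigl(\omega-\sin\omega-\frac23\sin^3\omega\Bigr)\,dP .$$ Moreover, the right-hand side is strictly positive if $\pi|F_e|-\Delta\neq0$, and it is equal to $0$ if $\pi|F_e|-\Delta=0$. -/

import Mathlib

open Real MeasureTheory

noncomputable section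

namespace Hurwitz

/-- The Euclidean plane. -/
abbrev Plane : Type := EuclideanSpace ℝ (Fin 2)

/-- The unit vector `N(φ) = (cos φ, sin φ)`. -/
def N (φ : ℝ) : Plane := !₂[Real.cos φ, Real.sin φ]

/-- The derivative `N'(φ) = (-sin φ, cos φ)` of `N`. -/
def N' (φ : ℝ) : Plane := !₂[-Real.sin φ, Real.cos φ]

/-- The support function `p(φ) = sup {⟨x, N(φ)⟩ : x ∈ K}` of `K`. -/
def supportFn (K : Set Plane) (φ : ℝ) : ℝ :=
  sSup ((fun x : Plane => inner ℝ x (N φ)) '' K)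

/-- A nonempty compact convex set whose support function is of class `C²` with everywhere
positive radius of curvature `p + p''`. The boundary of such a set is a simple closed curve of
class `C²` with positive curvature. -/
structure IsStrictlyConvexC2 (K : Set Plane) : Prop where
  nonempty : K.Nonempty
  isCompact : IsCompact K
  convex : Convex ℝ K
  contDiff : ContDiff ℝ 2 (supportFn K)
  radius_pos : ∀ φ : ℝ, 0 < supportFn K φ + deriv (deriv (supportFn K)) φ

/-- The length of the boundary `Γ = ∂K` (one-dimensional Hausdorff measure). -/
def length (K : Set Plane) : ℝ := (Measure.hausdorffMeasure 1 (frontier K)).toReal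

/-- The area of `K`. -/
def area (K : Set Plane) : ℝ := (volume K).toReal

/-- The isoperimetric deficit `Δ = L² - 4πF`. -/
def isoDeficit (K : Set Plane) : ℝ := length K ^ 2 - 4 * π * area K

/-- The point `γ(φ) = p(φ) N(φ) + p'(φ) N'(φ)` of `Γ` with outer normal vector `N(φ)`. -/
def boundaryPt (K : Set Plane) (φ : ℝ) : Plane :=
  supportFn K φ • N φ + deriv (supportFn K) φ • N' φ

/-- The area with multiplicities of the closed curve with `2π`-periodic generalized support
function `f`, that is, of the envelope of the lines `x cos t + y sin t = f t`, `0 ≤ t ≤ 2π`. For `f`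
of class `C²` it is `(1/2) ∫ f (f + f'')`, the area swept by the radius vector of the curve
(see `multArea_eq`); the form used here also makes sense for `f` of class `C¹`. -/
def multArea (f : ℝ → ℝ) : ℝ := (1 / 2) * ∫ t in (0 : ℝ)..(2 * π), (f t ^ 2 - deriv f t ^ 2)

theorem multArea_eq (f : ℝ → ℝ) (hf : ContDiff ℝ 2 f) (hper : Function.Periodic f (2 * π)) :
    multArea f = (1 / 2) * ∫ t in (0 : ℝ)..(2 * π), f t * (f t + deriv (deriv f) t) := by
  have hf1 : ContDiff ℝ 1 (deriv f) := by
    have h : ContDiff ℝ (1 + 1) f := by simpa [one_add_one_eq_two] using hf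
    exact (contDiff_succ_iff_deriv.1 h).2.2
  have hd : Differentiable ℝ f := hf.differentiable (by norm_num)
  have hd1 : Differentiable ℝ (deriv f) := hf1.differentiable (by norm_num)
  have hc0 : Continuous f := hd.continuous
  have hc1 : Continuous (deriv f) := hd1.continuous
  have hc2 : Continuous (deriv (deriv f)) := hf1.continuous_deriv le_rfl
  have hper' : deriv f (2 * π) = deriv f 0 := by
    have h := deriv_comp_add_const f (2 * π) 0
    have h2 : (fun x => f (x + 2 * π)) = f := funext hper
    rw [h2] at h
    simpa using h.symm
  have hp0 : f (2 * π) = f 0 := by simpa using hper 0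
  have key : ∫ t in (0 : ℝ)..(2 * π), (deriv f t * deriv f t + f t * deriv (deriv f) t) = 0 := by
    rw [intervalIntegral.integral_deriv_mul_eq_sub (fun x _ => (hd x).hasDerivAt)
      (fun x _ => (hd1 x).hasDerivAt) (hc1.intervalIntegrable _ _) (hc2.intervalIntegrable _ _),
      hp0, hper', sub_self]
  have hadd := intervalIntegral.integral_add (μ := volume) (a := 0) (b := 2 * π)
    (f := fun t => f t ^ 2 - deriv f t ^ 2)
    (g := fun t => deriv f t * deriv f t + f t * deriv (deriv f) t)
    (Continuous.intervalIntegrable (by fun_prop) _ _)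
    (Continuous.intervalIntegrable (by fun_prop) _ _)
  rw [key, add_zero] at hadd
  unfold multArea
  rw [← hadd]
  congr 2
  ext t
  ring

/-- The generalized support function of the evolute of `Γ`. The evolute is the envelope of the
normal lines of `Γ`; the normal line at `γ(t - π/2)` is orthogonal to `N'(t - π/2) = N(t)`, so it is
the line `⟨x, N(t)⟩ = ⟨γ(t - π/2), N(t)⟩`. -/
def evoluteSupport (K : Set Plane) (t : ℝ) : ℝ := inner ℝ (boundaryPt K (t - π / 2)) (N t)

theorem evoluteSupport_eq (K : Set Plane) (t : ℝ) :
    evoluteSupport K t = deriv (supportFn K) (t - π / 2) := by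
  have h := Real.sin_sq_add_cos_sq t
  simp only [evoluteSupport, boundaryPt, N, N', PiLp.inner_apply, Fin.sum_univ_two,
    PiLp.add_apply, PiLp.smul_apply, Real.cos_sub_pi_div_two, Real.sin_sub_pi_div_two]
  simp
  linear_combination (deriv (supportFn K) (t - π / 2)) * h

/-- The (algebraic) area with multiplicities `F_e` enclosed by the evolute of `Γ`. -/
def evoluteArea (K : Set Plane) : ℝ := multArea (evoluteSupport K)

/-- The Hurwitz deficit `π |F_e| - Δ`. -/
def hurwitzDeficit (K : Set Plane) : ℝ := π * |evoluteArea K| - isoDeficit K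

/-- The points of contact `A ∈ Γ` of the support (tangent) lines of `K` that pass through `P`. -/
def tangentPts (K : Set Plane) (P : Plane) : Set Plane :=
  {A | A ∈ frontier K ∧
    ∃ φ : ℝ, inner ℝ A (N φ) = supportFn K φ ∧ inner ℝ P (N φ) = supportFn K φ}

/-- The visual angle of `Γ` from `P ∉ K`: the angle `∠ A P B`, where `A` and `B` are the two points
of contact of the tangents from `P` to `Γ` (pairs with `A = B` only contribute the angle `0`). -/
def visualAngle (K : Set Plane) (P : Plane) : ℝ :=
  sSup {θ : ℝ | ∃ A ∈ tangentPts K P, ∃ B ∈ tangentPts K P, θ = EuclideanGeometry.angle A P B}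

/-- The function `ω - sin ω - (2/3) sin³ ω` of the visual angle `ω = ω(P)`. -/
def angleIntegrand (K : Set Plane) (P : Plane) : ℝ :=
  visualAngle K P - Real.sin (visualAngle K P) - (2 / 3) * Real.sin (visualAngle K P) ^ 3

/-- `(5/4) L² + 5 ∫_{P ∉ K} (ω - sin ω - (2/3) sin³ ω) dP`. -/
def visualBound (K : Set Plane) : ℝ :=
  (5 / 4) * length K ^ 2 + 5 * ∫ P in Kᶜ, angleIntegrand K P

end Hurwitz

end

/-!
A point `P ∉ K` lies on exactly two support lines, of directions `φ` and `φ + τ` with `0 < τ < π`,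
and `ω(P) = π - τ`. In the coordinates `(φ, τ)` the area measure has density
`gap p φ τ * gap p (φ + τ) (-τ) / sin³ τ`, where `gap p φ τ` is the distance from `γ(φ)` to the
second support line. For fixed `τ` the integral over `φ` is a combination of correlations
`∫ p(φ) p(φ + τ) dφ`, so that integrals of functions of `ω` become quadratic in the Fourier
coefficients of the support function `p`.

For `sin³ ω` the denominator disappears and only the frequencies `0` and `±2` remain. For
`ω - sin ω` (Crofton's formula) the integrand in `τ` differs from the derivative of
`gapEnergy p * croftonKernel / 2`, whose boundary values vanish, by a term without denominator.

With `xₙ` the squared modulus of the `n`-th coefficient, the right-hand side of the theorem is thus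
`5 π² ∑ (n² - 1) xₙ` over `n ≠ 0, ±2`, while `π |F_e| - Δ = π² ∑ (n² - 1) (n² - 4) xₙ` over `n ≠ 0`.
The frequencies `±1` and `±2` contribute to neither, and `n² - 4 ≥ 5` for `|n| ≥ 3`.
-/

noncomputable section

open Set Filter Topology

namespace Hurwitz

section Integral

variable {f g : ℝ → ℝ}

theorem integral_add_of_continuous (hf : Continuous f) (hg : Continuous g) (a b : ℝ) :
    ∫ x in a..b, (f x + g x) = (∫ x in a..b, f x) + ∫ x in a..b, g x :=
  intervalIntegral.integral_add (hf.intervalIntegrable a b) (hg.intervalIntegrable a b)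

theorem integral_sub_of_continuous (hf : Continuous f) (hg : Continuous g) (a b : ℝ) :
    ∫ x in a..b, (f x - g x) = (∫ x in a..b, f x) - ∫ x in a..b, g x :=
  intervalIntegral.integral_sub (hf.intervalIntegrable a b) (hg.intervalIntegrable a b)

theorem integral_deriv_eq_zero_of_periodic (hf : ∀ x, HasDerivAt f (g x) x) (hg : Continuous g)
    {T : ℝ} (hT : Function.Periodic f T) : ∫ x in (0 : ℝ)..T, g x = 0 := by
  rw [intervalIntegral.integral_eq_sub_of_hasDerivAt (fun x _ => hf x) (hg.intervalIntegrable _ _),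
    ← zero_add T, hT, sub_self]

theorem integral_comp_add_of_periodic {T : ℝ} (hf : Function.Periodic f T) (τ : ℝ) :
    ∫ x in (0 : ℝ)..T, f (x + τ) = ∫ x in (0 : ℝ)..T, f x := by
  rw [intervalIntegral.integral_comp_add_right, zero_add, add_comm T,
    hf.intervalIntegral_add_eq τ 0, zero_add]

theorem periodic_deriv {T : ℝ} (hf : Function.Periodic f T) : Function.Periodic (deriv f) T :=
  fun x => by rw [← deriv_comp_add_const, funext hf]

end Integral

/-- The radius of curvature `p + p''` of the curve with generalized support function `p`. -/
def radius (p : ℝ → ℝ) (φ : ℝ) : ℝ := p φ + deriv (deriv p) φ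

/-- A `2π`-periodic function of class `C²`, that is, the generalized support function of a closed
curve with a continuous radius of curvature. -/
structure IsPeriodicC2 (p : ℝ → ℝ) : Prop where
  contDiff : ContDiff ℝ 2 p
  periodic : Function.Periodic p (2 * π)

/-- A generalized support function with positive radius of curvature, that is, the support function
of a set satisfying `IsStrictlyConvexC2`. -/
structure IsSupport (p : ℝ → ℝ) : Prop extends IsPeriodicC2 p where
  radius_pos : ∀ φ, 0 < radius p φ

/-- The distance from the point `γ(φ) = p(φ) N(φ) + p'(φ) N'(φ)` to the line
`⟨x, N(φ + τ)⟩ = p(φ + τ)`. -/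
def gap (p : ℝ → ℝ) (φ τ : ℝ) : ℝ := p (φ + τ) - p φ * cos τ - deriv p φ * sin τ

namespace IsPeriodicC2

variable {p q : ℝ → ℝ}

theorem const (c : ℝ) : IsPeriodicC2 fun _ => c := ⟨contDiff_const, fun _ => rfl⟩

theorem hasDerivAt (hp : IsPeriodicC2 p) (x : ℝ) : HasDerivAt p (deriv p x) x :=
  (hp.contDiff.differentiable two_ne_zero x).hasDerivAt

theorem hasDerivAt_deriv (hp : IsPeriodicC2 p) (x : ℝ) :
    HasDerivAt (deriv p) (deriv (deriv p) x) x :=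
  (hp.contDiff.differentiable_deriv_two x).hasDerivAt

theorem continuous (hp : IsPeriodicC2 p) : Continuous p := hp.contDiff.continuous

theorem continuous_deriv (hp : IsPeriodicC2 p) : Continuous (deriv p) :=
  hp.contDiff.differentiable_deriv_two.continuous

theorem continuous_deriv2 (hp : IsPeriodicC2 p) : Continuous (deriv (deriv p)) :=
  ContDiff.continuous_deriv (n := 1) (ContDiff.deriv' (n := 1) hp.contDiff) le_rfl

theorem continuous_radius (hp : IsPeriodicC2 p) : Continuous (radius p) :=
  hp.continuous.add hp.continuous_deriv2

theorem periodic_radius (hp : IsPeriodicC2 p) : Function.Periodic (radius p) (2 * π) :=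
  hp.periodic.add (periodic_deriv (periodic_deriv hp.periodic))

theorem periodic_gap (hp : IsPeriodicC2 p) (φ : ℝ) : Function.Periodic (gap p φ) (2 * π) :=
  fun τ => by simp only [gap, ← add_assoc, hp.periodic _, cos_add_two_pi, sin_add_two_pi]

theorem gap_eq_integral (hp : IsPeriodicC2 p) (φ τ : ℝ) :
    gap p φ τ = ∫ s in (0 : ℝ)..τ, radius p (φ + s) * sin (τ - s) := by
  have hρ := hp.continuous_radius
  have hderiv (s : ℝ) : HasDerivAt (fun s => p (φ + s) * cos (τ - s) + deriv p (φ + s) *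
      sin (τ - s)) (radius p (φ + s) * sin (τ - s)) s := by
    have hs : HasDerivAt (fun s : ℝ => τ - s) (-1) s := (hasDerivAt_id s).const_sub τ
    convert! (((hp.hasDerivAt (φ + s)).comp_const_add φ s).mul hs.cos).add
      (((hp.hasDerivAt_deriv (φ + s)).comp_const_add φ s).mul hs.sin) using 1
    rw [radius]
    ring
  rw [intervalIntegral.integral_eq_sub_of_hasDerivAt (fun s _ => hderiv s)
    (Continuous.intervalIntegrable (by fun_prop) _ _)]
  simp only [gap, sub_self, cos_zero, sin_zero, add_zero, sub_zero]
  ring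

/-- By periodicity `τ ∈ [-π, π)`, and there `sin (τ - s)` has constant sign for `s` between `0` and
`τ`. -/
theorem gap_mono (hp : IsPeriodicC2 p) (hq : IsPeriodicC2 q) (h : ∀ φ, radius p φ ≤ radius q φ)
    (φ τ : ℝ) : gap p φ τ ≤ gap q φ τ := by
  obtain ⟨σ, hσ, hστ⟩ := ((hq.periodic_gap φ).sub (hp.periodic_gap φ)).exists_mem_Ico two_pi_pos
    τ (-π)
  simp only [Pi.sub_apply] at hστ
  suffices gap p φ σ ≤ gap q φ σ by linarith
  have hρp := hp.continuous_radius
  have hρq := hq.continuous_radius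
  rw [hp.gap_eq_integral, hq.gap_eq_integral]
  rcases le_total 0 σ with h0 | h0
  · refine intervalIntegral.integral_mono_on h0 (Continuous.intervalIntegrable (by fun_prop) _ _)
      (Continuous.intervalIntegrable (by fun_prop) _ _) fun s hs =>
      mul_le_mul_of_nonneg_right (h _) (sin_nonneg_of_nonneg_of_le_pi ?_ ?_)
    · linarith [hs.2]
    · linarith [hs.1, hσ.2]
  · rw [intervalIntegral.integral_symm, intervalIntegral.integral_symm σ, neg_le_neg_iff]
    refine intervalIntegral.integral_mono_on h0 (Continuous.intervalIntegrable (by fun_prop) _ _)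
      (Continuous.intervalIntegrable (by fun_prop) _ _) fun s hs =>
      mul_le_mul_of_nonpos_right (h _) (sin_nonpos_of_nonpos_of_neg_pi_le ?_ ?_)
    · linarith [hs.1]
    · linarith [hs.2, hσ.1]

theorem gap_le_of_radius_le (hp : IsPeriodicC2 p) {C : ℝ} (h : ∀ φ, radius p φ ≤ C) (φ τ : ℝ) :
    gap p φ τ ≤ C * (1 - cos τ) :=
  (hp.gap_mono (const C) (by simpa [radius] using h) φ τ).trans_eq (by simp [gap, mul_one_sub])

theorem le_gap_of_le_radius (hp : IsPeriodicC2 p) {c : ℝ} (h : ∀ φ, c ≤ radius p φ) (φ τ : ℝ) :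
    c * (1 - cos τ) ≤ gap p φ τ :=
  ((const c).gap_mono hp (by simpa [radius] using h) φ τ).trans_eq' (by simp [gap, mul_one_sub])

theorem exists_radius_mem_Icc (hp : IsPeriodicC2 p) :
    ∃ a b, ∀ φ, radius p φ ∈ Icc (radius p a) (radius p b) := by
  have hne : (Icc 0 (2 * π)).Nonempty := nonempty_Icc.2 two_pi_pos.le
  obtain ⟨a, -, ha⟩ := isCompact_Icc.exists_isMinOn hne hp.continuous_radius.continuousOn
  obtain ⟨b, -, hb⟩ := isCompact_Icc.exists_isMaxOn hne hp.continuous_radius.continuousOn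
  refine ⟨a, b, fun φ => ?_⟩
  obtain ⟨ψ, hψ, hφψ⟩ := hp.periodic_radius.exists_mem_Ico₀ two_pi_pos φ
  exact hφψ ▸ ⟨ha (Ico_subset_Icc_self hψ), hb (Ico_subset_Icc_self hψ)⟩

theorem exists_abs_gap_le (hp : IsPeriodicC2 p) :
    ∃ C, 0 ≤ C ∧ ∀ φ τ, |gap p φ τ| ≤ C * (1 - cos τ) := by
  obtain ⟨a, b, hab⟩ := hp.exists_radius_mem_Icc
  refine ⟨max |radius p a| |radius p b|, (abs_nonneg _).trans (le_max_left _ _), fun φ τ => ?_⟩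
  have hcos : 0 ≤ 1 - cos τ := sub_nonneg.2 (cos_le_one τ)
  rw [abs_le, ← neg_mul]
  constructor
  · refine le_trans (mul_le_mul_of_nonneg_right ?_ hcos)
      (hp.le_gap_of_le_radius (fun φ => (hab φ).1) φ τ)
    exact neg_le.1 ((neg_le_abs _).trans (le_max_left _ _))
  · refine (hp.gap_le_of_radius_le (fun φ => (hab φ).2) φ τ).trans
      (mul_le_mul_of_nonneg_right ?_ hcos)
    exact (le_abs_self _).trans (le_max_right _ _)

end IsPeriodicC2

theorem eq_of_angle_eq {α : Type*} {f : ℝ → α} (hf : Function.Periodic f (2 * π)) {φ ψ : ℝ}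
    (h : (φ : Real.Angle) = ψ) : f φ = f ψ := by
  obtain ⟨k, hk⟩ := Real.Angle.angle_eq_iff_two_pi_dvd_sub.1 h
  rw [show φ = ψ + k * (2 * π) by linarith, hf.int_mul]

theorem angle_eq_of_cos_sub_eq_one {φ ψ : ℝ} (h : cos (ψ - φ) = 1) : (φ : Real.Angle) = ψ := by
  obtain ⟨k, hk⟩ := (cos_eq_one_iff _).1 h
  exact (Real.Angle.angle_eq_iff_two_pi_dvd_sub.2 ⟨k, by linarith⟩).symm

theorem cos_lt_one_of_mem_Ioo {τ : ℝ} (hτ : τ ∈ Ioo 0 π) : cos τ < 1 :=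
  (cos_lt_cos_of_nonneg_of_le_pi le_rfl hτ.2.le hτ.1).trans_eq cos_zero

theorem eq_of_angle_eq_of_mem_Ico {φ ψ : ℝ} (hφ : φ ∈ Ico 0 (2 * π)) (hψ : ψ ∈ Ico 0 (2 * π))
    (h : (φ : Real.Angle) = ψ) : φ = ψ := by
  have : Fact (0 < 2 * π) := ⟨two_pi_pos⟩
  exact (AddCircle.coe_eq_coe_iff_of_mem_Ico (a := 0) (by simpa using hφ) (by simpa using hψ)).1 h

theorem angle_ne_angle_add {φ τ : ℝ} (hτ : τ ∈ Ioo 0 π) : (φ : Real.Angle) ≠ (φ + τ : ℝ) := by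
  intro h
  rw [Real.Angle.coe_add, left_eq_add] at h
  have := congrArg Real.Angle.cos h
  rw [Real.Angle.cos_coe, Real.Angle.cos_zero] at this
  exact (cos_lt_one_of_mem_Ioo hτ).ne this

namespace IsSupport

variable {p : ℝ → ℝ}

theorem gap_pos (hp : IsSupport p) (φ : ℝ) {τ : ℝ} (h : cos τ < 1) : 0 < gap p φ τ := by
  obtain ⟨a, b, hab⟩ := hp.exists_radius_mem_Icc
  exact (mul_pos (hp.radius_pos a) (sub_pos.2 h)).trans_le
    (hp.le_gap_of_le_radius (fun φ => (hab φ).1) φ τ)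

theorem deriv_mul_deriv_neg_of_zeros (hp : IsSupport p) {φ ψ : ℝ} (hne : (φ : Real.Angle) ≠ ψ)
    (hφ : p φ = 0) (hψ : p ψ = 0) : deriv p φ * deriv p ψ < 0 := by
  have hcos : cos (ψ - φ) < 1 :=
    (cos_le_one _).lt_of_ne fun h => hne (angle_eq_of_cos_sub_eq_one h)
  have h₁ := hp.gap_pos φ hcos
  have h₂ := hp.gap_pos ψ (τ := φ - ψ) (by rwa [← neg_sub, cos_neg])
  rw [gap, add_sub_cancel, hφ, hψ] at h₁ h₂
  rw [← neg_sub ψ φ, sin_neg] at h₂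
  nlinarith [mul_pos h₁ h₂, sq_nonneg (sin (ψ - φ))]

/-- At three distinct zeros the derivatives would have pairwise opposite signs. -/
theorem angle_eq_or_eq_of_zeros (hp : IsSupport p) {φ ψ χ : ℝ} (hne : (φ : Real.Angle) ≠ ψ)
    (hφ : p φ = 0) (hψ : p ψ = 0) (hχ : p χ = 0) :
    (χ : Real.Angle) = φ ∨ (χ : Real.Angle) = ψ := by
  by_contra! h
  have h₁ := hp.deriv_mul_deriv_neg_of_zeros hne hφ hψ
  have h₂ := hp.deriv_mul_deriv_neg_of_zeros h.1 hχ hφ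
  have h₃ := hp.deriv_mul_deriv_neg_of_zeros h.2 hχ hψ
  nlinarith [mul_pos (mul_pos_of_neg_of_neg h₁ h₂) (neg_pos.2 h₃),
    sq_nonneg (deriv p φ * deriv p χ * deriv p ψ)]

theorem deriv_neg_of_zeros (hp : IsSupport p) {φ τ : ℝ} (hτ : τ ∈ Ioo 0 π) (h₀ : p φ = 0)
    (h₁ : p (φ + τ) = 0) : deriv p φ < 0 := by
  have hsin := sin_pos_of_mem_Ioo hτ
  have := hp.gap_pos φ (cos_lt_one_of_mem_Ioo hτ)
  rw [gap, h₀, h₁] at this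
  nlinarith

theorem deriv_pos_of_zeros (hp : IsSupport p) {φ τ : ℝ} (hτ : τ ∈ Ioo 0 π) (h₀ : p φ = 0)
    (h₁ : p (φ + τ) = 0) : 0 < deriv p (φ + τ) := by
  have h := hp.deriv_mul_deriv_neg_of_zeros (angle_ne_angle_add hτ) h₀ h₁
  exact pos_of_mul_neg_right h (hp.deriv_neg_of_zeros hτ h₀ h₁).le

theorem zero_pair_unique (hp : IsSupport p) {φ τ φ' τ' : ℝ} (hτ : τ ∈ Ioo 0 π)
    (h₀ : p φ = 0) (h₁ : p (φ + τ) = 0) (hτ' : τ' ∈ Ioo 0 π) (h₀' : p φ' = 0)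
    (h₁' : p (φ' + τ') = 0) : (φ' : Real.Angle) = φ ∧ τ' = τ := by
  have hneg := hp.deriv_neg_of_zeros hτ' h₀' h₁'
  have hpos := hp.deriv_pos_of_zeros hτ' h₀' h₁'
  have hper := periodic_deriv hp.periodic
  have hφ : (φ' : Real.Angle) = φ := by
    refine (hp.angle_eq_or_eq_of_zeros (angle_ne_angle_add hτ) h₀ h₁ h₀').resolve_right fun h => ?_
    exact (hneg.trans (hp.deriv_pos_of_zeros hτ h₀ h₁)).ne (eq_of_angle_eq hper h)
  have hadd : ((φ' + τ' : ℝ) : Real.Angle) = (φ + τ : ℝ) := by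
    refine (hp.angle_eq_or_eq_of_zeros (angle_ne_angle_add hτ) h₀ h₁ h₁').resolve_left fun h => ?_
    exact ((hp.deriv_neg_of_zeros hτ h₀ h₁).trans hpos).ne' (eq_of_angle_eq hper h)
  rw [Real.Angle.coe_add, Real.Angle.coe_add, hφ, add_right_inj] at hadd
  exact ⟨hφ, eq_of_angle_eq_of_mem_Ico ⟨hτ'.1.le, by linarith [hτ'.2, pi_pos]⟩
    ⟨hτ.1.le, by linarith [hτ.2, pi_pos]⟩ hadd⟩

theorem exists_neg_of_zeros (hp : IsSupport p) {φ τ : ℝ} (hτ : τ ∈ Ioo 0 π) (h₀ : p φ = 0)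
    (h₁ : p (φ + τ) = 0) : ∃ ψ, p ψ < 0 := by
  by_contra! hc
  have hmin : IsLocalMin p φ := Eventually.of_forall fun x => h₀ ▸ hc x
  exact (hp.deriv_neg_of_zeros hτ h₀ h₁).ne hmin.deriv_eq_zero

theorem add_apply_add_pi_pos (hp : IsSupport p) (φ : ℝ) : 0 < p φ + p (φ + π) := by
  have := hp.gap_pos φ (τ := π) (by norm_num)
  simp only [gap, cos_pi, sin_pi] at this
  linarith

theorem exists_zeros_of_neg (hp : IsSupport p) {ψ : ℝ} (h : p ψ < 0) :
    ∃ φ, ∃ τ ∈ Ioo 0 π, p φ = 0 ∧ p (φ + τ) = 0 := by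
  have hleft : 0 < p (ψ - π) := by
    have := hp.add_apply_add_pi_pos (ψ - π)
    rw [sub_add_cancel] at this
    linarith
  obtain ⟨φ, hφ, h₀⟩ := intermediate_value_Ioo' (by linarith [pi_pos] : ψ - π ≤ ψ)
    hp.continuous.continuousOn ⟨h, hleft⟩
  have hright : 0 < p (φ + π) := by linarith [hp.add_apply_add_pi_pos φ]
  obtain ⟨χ, hχ, h₁⟩ := intermediate_value_Ioo (by linarith [hφ.1] : ψ ≤ φ + π)
    hp.continuous.continuousOn ⟨h, hright⟩
  exact ⟨φ, χ - φ, ⟨by linarith [hφ.2, hχ.1], by linarith [hχ.2]⟩, h₀, by rwa [add_sub_cancel]⟩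

end IsSupport

theorem inner_N (x : Plane) (φ : ℝ) : inner ℝ x (N φ) = x 0 * cos φ + x 1 * sin φ := by
  simp [N, PiLp.inner_apply, Fin.sum_univ_two, mul_comm]

theorem inner_N' (x : Plane) (φ : ℝ) : inner ℝ x (N' φ) = -x 0 * sin φ + x 1 * cos φ := by
  simp [N', PiLp.inner_apply, Fin.sum_univ_two, mul_comm]

theorem inner_N_N (φ ψ : ℝ) : inner ℝ (N φ) (N ψ) = cos (ψ - φ) := by
  rw [inner_N]
  simp [N, cos_sub, mul_comm]

theorem inner_N'_N (φ ψ : ℝ) : inner ℝ (N' φ) (N ψ) = sin (ψ - φ) := by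
  simp only [inner_N, N', Matrix.cons_val_zero, Matrix.cons_val_one, sin_sub]
  ring

theorem inner_N_N' (φ ψ : ℝ) : inner ℝ (N φ) (N' ψ) = -sin (ψ - φ) := by
  rw [real_inner_comm, inner_N'_N, ← sin_neg, neg_sub]

theorem inner_N'_N' (φ ψ : ℝ) : inner ℝ (N' φ) (N' ψ) = cos (ψ - φ) := by
  rw [inner_N']
  simp only [N', Matrix.cons_val_zero, Matrix.cons_val_one, cos_sub]
  ring

theorem norm_N (φ : ℝ) : ‖N φ‖ = 1 := by
  rw [norm_eq_sqrt_real_inner, inner_N_N, sub_self, cos_zero, sqrt_one]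

theorem norm_N' (φ : ℝ) : ‖N' φ‖ = 1 := by
  rw [norm_eq_sqrt_real_inner, inner_N'_N', sub_self, cos_zero, sqrt_one]

theorem periodic_N : Function.Periodic N (2 * π) := fun φ => by simp [N]

theorem periodic_N' : Function.Periodic N' (2 * π) := fun φ => by simp [N']

theorem hasDerivAt_vec {f g : ℝ → ℝ} {f' g' t : ℝ} (hf : HasDerivAt f f' t)
    (hg : HasDerivAt g g' t) : HasDerivAt (fun t => (!₂[f t, g t] : Plane)) !₂[f', g'] t := by
  rw [hasDerivAt_iff_hasFDerivAt, ← hasFDerivWithinAt_univ, hasFDerivWithinAt_euclidean]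
  intro i
  rw [hasFDerivWithinAt_univ]
  fin_cases i
  · convert! hf.hasFDerivAt using 1
  · convert! hg.hasFDerivAt using 1

theorem hasDerivAt_N (φ : ℝ) : HasDerivAt N (N' φ) φ :=
  hasDerivAt_vec (hasDerivAt_cos φ) (hasDerivAt_sin φ)

theorem hasDerivAt_N' (φ : ℝ) : HasDerivAt N' (-N φ) φ := by
  convert! hasDerivAt_vec (hasDerivAt_sin φ).neg (hasDerivAt_cos φ) using 1
  ext i
  fin_cases i <;> simp [N]

theorem eq_smul_N_add_smul_N' (x : Plane) (φ : ℝ) :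
    x = (inner ℝ x (N φ) : ℝ) • N φ + (inner ℝ x (N' φ) : ℝ) • N' φ := by
  have h := sin_sq_add_cos_sq φ
  rw [inner_N, inner_N']
  ext i
  fin_cases i
  · simp only [N, N', Fin.zero_eta, PiLp.add_apply, PiLp.smul_apply, Matrix.cons_val_zero,
      smul_eq_mul]
    linear_combination (-x 0) * h
  · simp only [N, N', Fin.mk_one, PiLp.add_apply, PiLp.smul_apply, Matrix.cons_val_one,
      Matrix.cons_val_fin_one, smul_eq_mul]
    linear_combination (-x 1) * h

theorem exists_eq_smul_N (v : Plane) : ∃ r φ : ℝ, 0 ≤ r ∧ v = r • N φ := by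
  refine ⟨‖(⟨v 0, v 1⟩ : ℂ)‖, Complex.arg ⟨v 0, v 1⟩, norm_nonneg _, ?_⟩
  ext i
  fin_cases i
  · simp [N, Complex.norm_mul_cos_arg]
  · simp [N, Complex.norm_mul_sin_arg]

theorem periodic_supportFn (K : Set Plane) : Function.Periodic (supportFn K) (2 * π) :=
  fun φ => by rw [supportFn, periodic_N, supportFn]

section SupportFn

variable {K : Set Plane} (hK : IsCompact K)
include hK

theorem inner_le_supportFn {x : Plane} (hx : x ∈ K) (φ : ℝ) : inner ℝ x (N φ) ≤ supportFn K φ :=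
  le_csSup (hK.image (by fun_prop)).bddAbove ⟨x, hx, rfl⟩

theorem exists_inner_eq_supportFn (hne : K.Nonempty) (φ : ℝ) :
    ∃ x ∈ K, inner ℝ x (N φ) = supportFn K φ :=
  (hK.image (f := fun x : Plane => (inner ℝ x (N φ) : ℝ)) (by fun_prop)).sSup_mem (hne.image _)

theorem mem_iff_forall_inner_le_supportFn (hne : K.Nonempty) (hconv : Convex ℝ K) {x : Plane} :
    x ∈ K ↔ ∀ φ, inner ℝ x (N φ) ≤ supportFn K φ := by
  refine ⟨fun hx => inner_le_supportFn hK hx, fun h => ?_⟩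
  by_contra hx
  obtain ⟨f, u, hKu, hux⟩ := geometric_hahn_banach_closed_point hconv hK.isClosed hx
  obtain ⟨v, rfl⟩ := (InnerProductSpace.toDual ℝ Plane).surjective f
  obtain ⟨r, φ, hr, rfl⟩ := exists_eq_smul_N v
  obtain ⟨y, hy, hyφ⟩ := exists_inner_eq_supportFn hK hne φ
  have hyu := hKu y hy
  simp only [InnerProductSpace.toDual_apply_apply, real_inner_smul_left] at hyu hux
  rw [real_inner_comm] at hyu hux
  rw [hyφ] at hyu
  linarith [mul_le_mul_of_nonneg_left (h φ) hr]

end SupportFn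

theorem inner_boundaryPt (K : Set Plane) (φ τ : ℝ) :
    inner ℝ (boundaryPt K φ) (N (φ + τ)) = supportFn K (φ + τ) - gap (supportFn K) φ τ := by
  rw [boundaryPt, inner_add_left, real_inner_smul_left, real_inner_smul_left, inner_N_N, inner_N'_N,
    add_sub_cancel_left, gap]
  ring

theorem inner_boundaryPt_self (K : Set Plane) (φ : ℝ) :
    inner ℝ (boundaryPt K φ) (N φ) = supportFn K φ := by
  simpa [gap] using inner_boundaryPt K φ 0

theorem inner_boundaryPt_N' (K : Set Plane) (φ : ℝ) :
    inner ℝ (boundaryPt K φ) (N' φ) = deriv (supportFn K) φ := by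
  simp [boundaryPt, inner_add_left, real_inner_smul_left, inner_N_N', norm_N']

/-- The support function of `K` with respect to the point `P` as origin. -/
def supportFrom (K : Set Plane) (P : Plane) (φ : ℝ) : ℝ := supportFn K φ - inner ℝ P (N φ)

theorem hasDerivAt_inner_N (P : Plane) (φ : ℝ) :
    HasDerivAt (fun φ => (inner ℝ P (N φ) : ℝ)) (inner ℝ P (N' φ)) φ := by
  simpa using (hasDerivAt_const φ P).inner ℝ (hasDerivAt_N φ)

theorem hasDerivAt_inner_N' (P : Plane) (φ : ℝ) :
    HasDerivAt (fun φ => (inner ℝ P (N' φ) : ℝ)) (-inner ℝ P (N φ)) φ := by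
  simpa using (hasDerivAt_const φ P).inner ℝ (hasDerivAt_N' φ)

namespace IsStrictlyConvexC2

variable {K : Set Plane}

theorem isSupport (hK : IsStrictlyConvexC2 K) : IsSupport (supportFn K) :=
  ⟨⟨hK.contDiff, periodic_supportFn K⟩, hK.radius_pos⟩

theorem hasDerivAt_boundaryPt (hK : IsStrictlyConvexC2 K) (φ : ℝ) :
    HasDerivAt (boundaryPt K) (radius (supportFn K) φ • N' φ) φ := by
  convert! ((hK.isSupport.hasDerivAt φ).smul (hasDerivAt_N φ)).add
    ((hK.isSupport.hasDerivAt_deriv φ).smul (hasDerivAt_N' φ)) using 1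
  rw [radius]
  module

theorem periodic_boundaryPt (hK : IsStrictlyConvexC2 K) :
    Function.Periodic (boundaryPt K) (2 * π) := fun φ => by
  rw [boundaryPt, periodic_N, periodic_N', hK.isSupport.periodic,
    periodic_deriv hK.isSupport.periodic, boundaryPt]

theorem deriv_supportFrom (hK : IsStrictlyConvexC2 K) (P : Plane) :
    deriv (supportFrom K P) = fun φ => deriv (supportFn K) φ - inner ℝ P (N' φ) :=
  funext fun φ => ((hK.isSupport.hasDerivAt φ).sub (hasDerivAt_inner_N P φ)).deriv

theorem radius_supportFrom (hK : IsStrictlyConvexC2 K) (P : Plane) (φ : ℝ) :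
    radius (supportFrom K P) φ = radius (supportFn K) φ := by
  rw [radius, hK.deriv_supportFrom,
    ((hK.isSupport.hasDerivAt_deriv φ).fun_sub (hasDerivAt_inner_N' P φ)).deriv, supportFrom,
    radius]
  ring

theorem isSupport_supportFrom (hK : IsStrictlyConvexC2 K) (P : Plane) :
    IsSupport (supportFrom K P) := by
  refine ⟨⟨?_, fun φ => ?_⟩, fun φ => hK.radius_supportFrom P φ ▸ hK.radius_pos φ⟩
  · unfold supportFrom
    simp only [inner_N]
    exact hK.contDiff.sub ((contDiff_const.mul contDiff_cos).add (contDiff_const.mul contDiff_sin))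
  · rw [supportFrom, periodic_supportFn K, periodic_N, supportFrom]

theorem mem_iff (hK : IsStrictlyConvexC2 K) {x : Plane} : x ∈ K ↔ ∀ φ, 0 ≤ supportFrom K x φ := by
  simp_rw [mem_iff_forall_inner_le_supportFn hK.isCompact hK.nonempty hK.convex, supportFrom,
    sub_nonneg]

theorem mem_interior_iff (hK : IsStrictlyConvexC2 K) {x : Plane} :
    x ∈ interior K ↔ ∀ φ, 0 < supportFrom K x φ := by
  constructor
  · refine fun hx φ => (hK.mem_iff.1 (interior_subset hx) φ).lt_of_ne fun h0 => ?_
    have hmax : IsMaxOn (innerSL ℝ (N φ)) K x := fun y hy => by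
      simpa [real_inner_comm, sub_eq_zero.1 h0.symm] using inner_le_supportFn hK.isCompact hy φ
    have hzero := (hmax.isLocalMax (mem_interior_iff_mem_nhds.1 hx)).hasFDerivAt_eq_zero
      (innerSL ℝ (N φ)).hasFDerivAt
    simpa [norm_N] using congrArg (fun f => f (N φ)) hzero
  · intro hpos
    have hs := hK.isSupport_supportFrom x
    obtain ⟨φ₀, -, hφ₀⟩ := (isCompact_Icc (a := (0 : ℝ)) (b := 2 * π)).exists_isMinOn
      (nonempty_Icc.2 (by positivity)) hs.continuous.continuousOn
    refine mem_interior_iff_mem_nhds.2 (Metric.mem_nhds_iff.2 ⟨_, hpos φ₀, fun y hy => ?_⟩)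
    rw [hK.mem_iff]
    intro φ
    obtain ⟨χ, hχ, he⟩ := hs.periodic.exists_mem_Ico₀ two_pi_pos φ
    have hmin : supportFrom K x φ₀ ≤ supportFrom K x φ := he ▸ hφ₀ (Ico_subset_Icc_self hχ)
    have hnorm : (inner ℝ (y - x) (N φ) : ℝ) ≤ ‖y - x‖ * ‖N φ‖ := real_inner_le_norm _ _
    rw [norm_N, mul_one, ← dist_eq_norm, inner_sub_left] at hnorm
    rw [Metric.mem_ball] at hy
    unfold supportFrom at *
    linarith

theorem eq_boundaryPt (hK : IsStrictlyConvexC2 K) {x : Plane} (hx : x ∈ K) {φ : ℝ}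
    (h : supportFrom K x φ = 0) : x = boundaryPt K φ := by
  have hmin : IsLocalMin (supportFrom K x) φ :=
    Eventually.of_forall fun ψ => h ▸ hK.mem_iff.1 hx ψ
  have hderiv := hmin.deriv_eq_zero
  rw [hK.deriv_supportFrom] at hderiv
  rw [eq_smul_N_add_smul_N' x φ, ← sub_eq_zero.1 h, ← sub_eq_zero.1 hderiv, boundaryPt]

theorem supportFrom_boundaryPt (φ : ℝ) : supportFrom K (boundaryPt K φ) φ = 0 := by
  rw [supportFrom, inner_boundaryPt_self, sub_self]

theorem boundaryPt_mem (hK : IsStrictlyConvexC2 K) (φ : ℝ) : boundaryPt K φ ∈ K := by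
  obtain ⟨x, hx, h⟩ := exists_inner_eq_supportFn hK.isCompact hK.nonempty φ
  rwa [← hK.eq_boundaryPt hx (by rw [supportFrom, h, sub_self])]

theorem mem_frontier_iff (hK : IsStrictlyConvexC2 K) {x : Plane} :
    x ∈ frontier K ↔ x ∈ K ∧ ∃ φ, supportFrom K x φ = 0 := by
  rw [hK.isCompact.isClosed.frontier_eq, Set.mem_sdiff, hK.mem_interior_iff]
  refine and_congr_right fun hx => ?_
  push Not
  exact exists_congr fun φ => ⟨fun h => h.antisymm (hK.mem_iff.1 hx φ), le_of_eq⟩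

theorem boundaryPt_mem_frontier (hK : IsStrictlyConvexC2 K) (φ : ℝ) : boundaryPt K φ ∈ frontier K :=
  hK.mem_frontier_iff.2 ⟨hK.boundaryPt_mem φ, φ, supportFrom_boundaryPt φ⟩

theorem frontier_eq_image (hK : IsStrictlyConvexC2 K) :
    frontier K = boundaryPt K '' Ico 0 (2 * π) := by
  refine Subset.antisymm (fun x hx => ?_) (image_subset_iff.2 fun φ _ => ?_)
  · obtain ⟨hxK, φ, hφ⟩ := hK.mem_frontier_iff.1 hx
    obtain ⟨ψ, hψ, h⟩ := hK.periodic_boundaryPt.exists_mem_Ico₀ two_pi_pos φ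
    exact ⟨ψ, hψ, by rw [hK.eq_boundaryPt hxK hφ, h]⟩
  · exact hK.boundaryPt_mem_frontier φ

theorem angle_eq_of_boundaryPt_eq (hK : IsStrictlyConvexC2 K) {φ ψ : ℝ}
    (h : boundaryPt K φ = boundaryPt K ψ) : (φ : Real.Angle) = ψ := by
  refine angle_eq_of_cos_sub_eq_one (by_contra fun hcos => ?_)
  have hgap := hK.isSupport.gap_pos φ ((cos_le_one _).lt_of_ne hcos)
  have hinner := inner_boundaryPt K φ (ψ - φ)
  rw [add_sub_cancel, h, inner_boundaryPt_self] at hinner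
  linarith

theorem injOn_boundaryPt (hK : IsStrictlyConvexC2 K) : InjOn (boundaryPt K) (Ico 0 (2 * π)) :=
  fun _ hφ _ hψ h => eq_of_angle_eq_of_mem_Ico hφ hψ (hK.angle_eq_of_boundaryPt_eq h)

theorem tangentPts_eq_image (hK : IsStrictlyConvexC2 K) (P : Plane) :
    tangentPts K P = boundaryPt K '' {φ | supportFrom K P φ = 0} := by
  ext A
  constructor
  · rintro ⟨hA, φ, hAφ, hPφ⟩
    refine ⟨φ, by rw [mem_ofPred_eq, supportFrom, hPφ, sub_self], ?_⟩
    exact (hK.eq_boundaryPt (hK.mem_frontier_iff.1 hA).1 (by rw [supportFrom, hAφ, sub_self])).symm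
  · rintro ⟨φ, hφ, rfl⟩
    exact ⟨hK.boundaryPt_mem_frontier φ, φ, inner_boundaryPt_self K φ, (sub_eq_zero.1 hφ).symm⟩

theorem tangentPts_eq_pair (hK : IsStrictlyConvexC2 K) {P : Plane} {φ τ : ℝ} (hτ : τ ∈ Ioo 0 π)
    (h₀ : supportFrom K P φ = 0) (h₁ : supportFrom K P (φ + τ) = 0) :
    tangentPts K P = {boundaryPt K φ, boundaryPt K (φ + τ)} := by
  rw [hK.tangentPts_eq_image]
  have hs := hK.isSupport_supportFrom P
  refine Subset.antisymm (image_subset_iff.2 fun ψ hψ => ?_) ?_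
  · exact (hs.angle_eq_or_eq_of_zeros (angle_ne_angle_add hτ) h₀ h₁ hψ).imp
      (eq_of_angle_eq hK.periodic_boundaryPt) (eq_of_angle_eq hK.periodic_boundaryPt)
  · rw [insert_subset_iff, singleton_subset_iff]
    exact ⟨⟨φ, h₀, rfl⟩, φ + τ, h₁, rfl⟩

theorem boundaryPt_sub (hK : IsStrictlyConvexC2 K) (P : Plane) (φ : ℝ) : boundaryPt K φ - P =
    supportFrom K P φ • N φ + deriv (supportFrom K P) φ • N' φ := by
  rw [eq_smul_N_add_smul_N' (boundaryPt K φ - P) φ, inner_sub_left, inner_sub_left,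
    inner_boundaryPt_self, inner_boundaryPt_N', hK.deriv_supportFrom, ← supportFrom]

theorem boundaryPt_sub_of_eq_zero (hK : IsStrictlyConvexC2 K) {P : Plane} {φ : ℝ}
    (h₀ : supportFrom K P φ = 0) :
    boundaryPt K φ - P = deriv (supportFrom K P) φ • N' φ := by
  rw [hK.boundaryPt_sub, h₀, zero_smul, zero_add]

theorem boundaryPt_ne (hK : IsStrictlyConvexC2 K) {P : Plane} {φ : ℝ} (h₀ : supportFrom K P φ = 0)
    (h : deriv (supportFrom K P) φ ≠ 0) : boundaryPt K φ ≠ P := by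
  rw [← sub_ne_zero, hK.boundaryPt_sub_of_eq_zero h₀]
  exact smul_ne_zero h (norm_ne_zero_iff.1 (by simp [norm_N']))

theorem angle_boundaryPt_boundaryPt (hK : IsStrictlyConvexC2 K) {P : Plane} {φ τ : ℝ}
    (hτ : τ ∈ Ioo 0 π) (h₀ : supportFrom K P φ = 0) (h₁ : supportFrom K P (φ + τ) = 0) :
    EuclideanGeometry.angle (boundaryPt K φ) P (boundaryPt K (φ + τ)) = π - τ := by
  have hs := hK.isSupport_supportFrom P
  rw [EuclideanGeometry.angle, vsub_eq_sub, vsub_eq_sub, hK.boundaryPt_sub_of_eq_zero h₀,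
    hK.boundaryPt_sub_of_eq_zero h₁,
    InnerProductGeometry.angle_smul_right_of_pos _ _ (hs.deriv_pos_of_zeros hτ h₀ h₁),
    InnerProductGeometry.angle_smul_left_of_neg _ _ (hs.deriv_neg_of_zeros hτ h₀ h₁),
    InnerProductGeometry.angle_neg_left, InnerProductGeometry.angle, norm_N', norm_N', inner_N'_N',
    add_sub_cancel_left, mul_one, div_one, arccos_cos hτ.1.le hτ.2.le]

theorem visualAngle_eq (hK : IsStrictlyConvexC2 K) {P : Plane} {φ τ : ℝ} (hτ : τ ∈ Ioo 0 π)
    (h₀ : supportFrom K P φ = 0) (h₁ : supportFrom K P (φ + τ) = 0) :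
    visualAngle K P = π - τ := by
  have hs := hK.isSupport_supportFrom P
  have hang := hK.angle_boundaryPt_boundaryPt hτ h₀ h₁
  have hne₀ := hK.boundaryPt_ne h₀ (hs.deriv_neg_of_zeros hτ h₀ h₁).ne
  have hne₁ := hK.boundaryPt_ne h₁ (hs.deriv_pos_of_zeros hτ h₀ h₁).ne'
  rw [visualAngle, hK.tangentPts_eq_pair hτ h₀ h₁]
  refine IsGreatest.csSup_eq ⟨⟨_, by simp, _, by simp, hang.symm⟩, ?_⟩
  rintro θ ⟨A, rfl | rfl, B, rfl | rfl, rfl⟩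
  · rw [EuclideanGeometry.angle_self_of_ne hne₀]
    linarith [hτ.2]
  · exact hang.le
  · rw [EuclideanGeometry.angle_comm]
    exact hang.le
  · rw [EuclideanGeometry.angle_self_of_ne hne₁]
    linarith [hτ.2]

end IsStrictlyConvexC2

section CurveLength

theorem ofReal_mul_hausdorffMeasure_le_image {X Y : Type*} [MetricSpace X] [MeasurableSpace X]
    [BorelSpace X] [MetricSpace Y] [MeasurableSpace Y] [BorelSpace Y] {f : X → Y} {S : Set X}
    {c : ℝ} (h : ∀ x ∈ S, ∀ y ∈ S, c * dist x y ≤ dist (f x) (f y)) :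
    ENNReal.ofReal c * μH[1] S ≤ μH[1] (f '' S) := by
  rcases le_or_gt c 0 with hc | hc
  · simp [ENNReal.ofReal_of_nonpos hc]
  have hanti : AntilipschitzWith c⁻¹.toNNReal (S.domRestrict f) :=
    AntilipschitzWith.of_le_mul_dist fun x y => by
      rw [Real.coe_toNNReal _ (inv_pos.2 hc).le, inv_mul_eq_div, le_div_iff₀' hc]
      exact h x x.2 y y.2
  have hle := hanti.le_hausdorffMeasure_image zero_le_one univ
  rw [← isometry_subtype_coe.hausdorffMeasure_image (.inl zero_le_one), image_univ, image_univ,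
    Subtype.range_coe, range_domRestrict, ENNReal.rpow_one] at hle
  calc ENNReal.ofReal c * μH[1] S
      ≤ ENNReal.ofReal c * (ENNReal.ofReal c⁻¹ * μH[1] (f '' S)) := by
        gcongr
        exact hle
    _ = μH[1] (f '' S) := by
        rw [← mul_assoc, ← ENNReal.ofReal_mul hc.le, mul_inv_cancel₀ hc.ne', ENNReal.ofReal_one,
          one_mul]

theorem exists_lipschitzOnWith_Icc {E : Type*} [NormedAddCommGroup E] [NormedSpace ℝ E]
    {γ γ' : ℝ → E} (hγ : ∀ t, HasDerivAt γ (γ' t) t) (hγ' : Continuous γ') (a b : ℝ) :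
    ∃ C, LipschitzOnWith C γ (Icc a b) := by
  obtain ⟨C, hC⟩ := (isCompact_Icc (a := a) (b := b)).exists_bound_of_continuousOn hγ'.continuousOn
  refine ⟨C.toNNReal, (convex_Icc a b).lipschitzOnWith_of_nnnorm_hasDerivWithin_le
    (fun t _ => (hγ t).hasDerivWithinAt) fun t ht => ?_⟩
  rw [← NNReal.coe_le_coe, coe_nnnorm]
  exact (hC t ht).trans (Real.le_coe_toNNReal C)

variable {E : Type*} [NormedAddCommGroup E] [MeasurableSpace E] [BorelSpace E]
  {γ γ' : ℝ → E} {a b s t : ℝ}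

theorem hausdorffMeasure_image_Ico_le {C : NNReal} (h : LipschitzOnWith C γ (Ico s t)) :
    μH[1] (γ '' Ico s t) ≤ ENNReal.ofReal (C * (t - s)) := by
  have := h.hausdorffMeasure_image_le (d := 1) zero_le_one
  rwa [ENNReal.rpow_one, hausdorffMeasure_real, volume_Ico, ← ENNReal.ofReal_coe_nnreal,
    ← ENNReal.ofReal_mul C.coe_nonneg] at this

theorem hausdorffMeasure_image_Ico_sub {C : NNReal} (hC : LipschitzOnWith C γ (Icc a b))
    (hinj : InjOn γ (Ico a b)) (hs : s ∈ Icc a b) (ht : t ∈ Icc s b) :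
    (μH[1]).real (γ '' Ico a t) - (μH[1]).real (γ '' Ico a s) = (μH[1]).real (γ '' Ico s t) := by
  have hfin {x y : ℝ} (hx : a ≤ x) (hy : y ≤ b) : μH[1] (γ '' Ico x y) ≠ ⊤ :=
    ne_top_of_le_ne_top ENNReal.ofReal_ne_top
      (hausdorffMeasure_image_Ico_le (hC.mono (Ico_subset_Icc_self.trans (Icc_subset_Icc hx hy))))
  have hdisj : Disjoint (γ '' Ico a s) (γ '' Ico s t) := by
    rw [disjoint_iff_inter_eq_empty, ← hinj.image_inter (Ico_subset_Ico_right hs.2)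
      (Ico_subset_Ico hs.1 ht.2), Ico_disjoint_Ico_same.inter_eq, image_empty]
  have hmeas : MeasurableSet (γ '' Ico s t) := measurableSet_Ico.image_of_continuousOn_injOn
    (hC.continuousOn.mono (Ico_subset_Icc_self.trans (Icc_subset_Icc hs.1 ht.2)))
    (hinj.mono (Ico_subset_Ico hs.1 ht.2))
  rw [← Ico_union_Ico_eq_Ico hs.1 ht.1, image_union,
    measureReal_union hdisj hmeas (hfin le_rfl hs.2) (hfin hs.1 ht.2), add_sub_cancel_left]

theorem continuousOn_hausdorffMeasure_image_Ico {C : NNReal} (hC : LipschitzOnWith C γ (Icc a b))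
    (hinj : InjOn γ (Ico a b)) :
    ContinuousOn (fun t => (μH[1]).real (γ '' Ico a t)) (Icc a b) := by
  refine (LipschitzOnWith.of_dist_le_mul (K := C) fun t ht s hs => ?_).continuousOn
  wlog hst : s ≤ t generalizing s t
  · rw [dist_comm, dist_comm t]
    exact this s hs t ht (le_of_not_ge hst)
  rw [Real.dist_eq, Real.dist_eq, hausdorffMeasure_image_Ico_sub hC hinj hs ⟨hst, ht.2⟩,
    abs_of_nonneg measureReal_nonneg, abs_of_nonneg (sub_nonneg.2 hst)]
  exact ENNReal.toReal_le_of_le_ofReal (mul_nonneg C.coe_nonneg (sub_nonneg.2 hst))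
    (hausdorffMeasure_image_Ico_le (hC.mono (Ico_subset_Icc_self.trans (Icc_subset_Icc hs.1 ht.2))))

variable [NormedSpace ℝ E]

theorem abs_hausdorffMeasure_image_sub_le {v : E} {ε : ℝ} (hε : 0 ≤ ε) (hst : s ≤ t)
    (h : ∀ x ∈ Ico s t, ∀ y ∈ Ico s t, ‖γ x - γ y - (x - y) • v‖ ≤ ε * ‖x - y‖) :
    |(μH[1]).real (γ '' Ico s t) - ‖v‖ * (t - s)| ≤ ε * (t - s) := by
  have hupper : LipschitzOnWith (‖v‖ + ε).toNNReal γ (Ico s t) :=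
    LipschitzOnWith.of_dist_le_mul fun x hx y hy => by
      have := norm_sub_norm_le (γ x - γ y) ((x - y) • v)
      rw [norm_smul] at this
      rw [Real.coe_toNNReal _ (by positivity), dist_eq_norm, dist_eq_norm]
      linarith [h x hx y hy]
  have hlower : ∀ x ∈ Ico s t, ∀ y ∈ Ico s t, (‖v‖ - ε) * dist x y ≤ dist (γ x) (γ y) :=
    fun x hx y hy => by
      have := norm_sub_norm_le ((x - y) • v) (γ x - γ y)
      rw [norm_smul, norm_sub_rev _ (γ x - γ y)] at this
      rw [dist_eq_norm, dist_eq_norm]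
      linarith [h x hx y hy]
  have hle := hausdorffMeasure_image_Ico_le hupper
  have hge := ofReal_mul_hausdorffMeasure_le_image hlower
  have hfin := ne_top_of_le_ne_top ENNReal.ofReal_ne_top hle
  rw [hausdorffMeasure_real, volume_Ico, ← ENNReal.ofReal_mul' (sub_nonneg.2 hst),
    ENNReal.ofReal_le_iff_le_toReal hfin] at hge
  rw [Real.coe_toNNReal _ (by positivity)] at hle
  have hle' := ENNReal.toReal_le_of_le_ofReal
    (mul_nonneg (by positivity) (sub_nonneg.2 hst)) hle
  rw [abs_le, Measure.real]
  constructor <;> linarith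

theorem hasDerivWithinAt_hausdorffMeasure_image_Ico {C : NNReal}
    (hC : LipschitzOnWith C γ (Icc a b)) (hinj : InjOn γ (Ico a b)) {v : E} (hs : s ∈ Ico a b)
    (hγ : HasStrictDerivAt γ v s) :
    HasDerivWithinAt (fun t => (μH[1]).real (γ '' Ico a t)) ‖v‖ (Ioi s) s := by
  rw [hasDerivWithinAt_iff_isLittleO, Asymptotics.isLittleO_iff]
  intro ε hε
  have hnear := (hasDerivAtFilter_iff_isLittleO.1 hγ).def hε
  obtain ⟨u, hu, hclose⟩ := mem_prod_self_iff.1 (nhds_prod_eq (x := s) (y := s) ▸ hnear)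
  obtain ⟨δ, hδ, hball⟩ := Metric.mem_nhds_iff.1 hu
  filter_upwards [Ioo_mem_nhdsGT (lt_min (lt_add_of_pos_right s hδ) hs.2)] with x hx
  have hsx := hx.1
  obtain ⟨hxδ, hxb⟩ := lt_min_iff.1 hx.2
  have hmem (y : ℝ) (hy : y ∈ Ico s x) : y ∈ u := hball (by
    rw [Metric.mem_ball, Real.dist_eq, abs_of_nonneg (sub_nonneg.2 hy.1)]
    linarith [hy.2])
  rw [hausdorffMeasure_image_Ico_sub hC hinj (Ico_subset_Icc_self hs) ⟨hsx.le, hxb.le⟩,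
    Real.norm_eq_abs, Real.norm_eq_abs, abs_of_pos (sub_pos.2 hsx), smul_eq_mul, mul_comm _ ‖v‖]
  exact abs_hausdorffMeasure_image_sub_le hε.le hsx.le
    fun y hy z hz => hclose (mk_mem_prod (hmem y hy) (hmem z hz))

/-- The Hausdorff measure of `γ '' Ico a t` has right derivative `‖γ' t‖` because `γ` is close to an
affine map at small scales. -/
theorem hausdorffMeasure_image_Ico_eq_integral_norm_deriv (hab : a ≤ b)
    (hγ : ∀ t, HasDerivAt γ (γ' t) t) (hγ' : Continuous γ') (hinj : InjOn γ (Ico a b)) :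
    (μH[1]).real (γ '' Ico a b) = ∫ t in a..b, ‖γ' t‖ := by
  obtain ⟨C, hC⟩ := exists_lipschitzOnWith_Icc hγ hγ' a b
  rw [intervalIntegral.integral_eq_sub_of_hasDeriv_right_of_le hab
    (continuousOn_hausdorffMeasure_image_Ico hC hinj)
    (fun t ht => hasDerivWithinAt_hausdorffMeasure_image_Ico hC hinj (Ioo_subset_Ico_self ht)
      (hasStrictDerivAt_of_hasDerivAt_of_continuousAt (Eventually.of_forall hγ)
        hγ'.continuousAt)) (hγ'.norm.intervalIntegrable a b), Ico_self, image_empty,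
    measureReal_empty, sub_zero]

end CurveLength

namespace IsPeriodicC2

variable {p : ℝ → ℝ}

theorem integral_radius (hp : IsPeriodicC2 p) :
    ∫ φ in (0 : ℝ)..2 * π, radius p φ = ∫ φ in (0 : ℝ)..2 * π, p φ := by
  simp_rw [radius]
  rw [integral_add_of_continuous hp.continuous hp.continuous_deriv2,
    integral_deriv_eq_zero_of_periodic hp.hasDerivAt_deriv hp.continuous_deriv2
      (periodic_deriv hp.periodic), add_zero]

end IsPeriodicC2

theorem IsStrictlyConvexC2.length_eq {K : Set Plane} (hK : IsStrictlyConvexC2 K) :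
    length K = ∫ φ in (0 : ℝ)..2 * π, supportFn K φ := by
  have hnorm (φ : ℝ) : ‖radius (supportFn K) φ • N' φ‖ = radius (supportFn K) φ := by
    rw [norm_smul, norm_N', mul_one, Real.norm_of_nonneg (hK.isSupport.radius_pos φ).le]
  have hcont : Continuous N' :=
    continuous_iff_continuousAt.2 fun φ => (hasDerivAt_N' φ).continuousAt
  rw [← hK.isSupport.integral_radius, ← intervalIntegral.integral_congr fun φ _ => hnorm φ,
    ← hausdorffMeasure_image_Ico_eq_integral_norm_deriv two_pi_pos.le hK.hasDerivAt_boundaryPt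
      (hK.isSupport.continuous_radius.smul hcont) hK.injOn_boundaryPt, ← hK.frontier_eq_image]
  rfl

section Frontier

variable {E : Type*} [NormedAddCommGroup E] [NormedSpace ℝ E] {K : Set E}

/-- The coordinate along the segments is the gauge of `K` with respect to the origin `c`. -/
theorem bijOn_add_smul_sub_frontier (hK : IsClosed K) (hb : Bornology.IsBounded K)
    (hconv : Convex ℝ K) {c : E} (hc : c ∈ interior K) :
    BijOn (fun q : ℝ × E => c + q.1 • (q.2 - c)) (Ioc 0 1 ×ˢ frontier K) (K \ {c}) := by
  set K₀ := (c + ·) ⁻¹' K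
  have hconv₀ : Convex ℝ K₀ := hconv.translate_preimage_right c
  have hnhds : K₀ ∈ 𝓝 0 := (continuous_const_add c).continuousAt.preimage_mem_nhds
    (by simpa using mem_interior_iff_mem_nhds.1 hc)
  have hb₀ : Bornology.IsBounded K₀ := (isometry_add_left c).antilipschitz.isBounded_preimage hb
  have hfrontier (v : E) : gauge K₀ v = 1 ↔ c + v ∈ frontier K := by
    rw [gauge_eq_one_iff_mem_frontier hconv₀ hnhds]
    exact Set.ext_iff.1 ((Homeomorph.addLeft c).preimage_frontier K).symm v
  have hle (v : E) : gauge K₀ v ≤ 1 ↔ c + v ∈ K := by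
    rw [gauge_le_one_iff_mem_closure hconv₀ hnhds,
      (hK.preimage (continuous_const_add c)).closure_eq, mem_preimage]
  have hpos (v : E) : 0 < gauge K₀ v ↔ v ≠ 0 :=
    gauge_pos (absorbent_nhds_zero hnhds) ((NormedSpace.isVonNBounded_iff ℝ).2 hb₀)
  have hgauge {q : ℝ × E} (hq : q ∈ Ioc (0 : ℝ) 1 ×ˢ frontier K) :
      gauge K₀ (q.1 • (q.2 - c)) = q.1 := by
    rw [gauge_smul_of_nonneg hq.1.1.le, (hfrontier _).2 (by rw [add_sub_cancel]; exact hq.2),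
      smul_eq_mul, mul_one]
  refine ⟨fun q hq => ⟨?_, ?_⟩, fun q hq r hr h => ?_, fun x hx => ?_⟩
  · exact (hle _).1 ((hgauge hq).trans_le hq.1.2)
  · rw [mem_singleton_iff, add_eq_left]
    exact (hpos _).1 ((hgauge hq).symm ▸ hq.1.1)
  · have hsmul := add_left_cancel h
    have hfst : q.1 = r.1 := by rw [← hgauge hq, ← hgauge hr, hsmul]
    rw [← hfst] at hsmul
    exact Prod.ext hfst (sub_left_injective (smul_right_injective E hq.1.1.ne' hsmul))
  · have hx0 := (hpos (x - c)).2 (sub_ne_zero.2 hx.2)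
    refine ⟨(gauge K₀ (x - c), c + (gauge K₀ (x - c))⁻¹ • (x - c)), ⟨⟨hx0, ?_⟩, ?_⟩, ?_⟩
    · exact (hle _).2 (by rw [add_sub_cancel]; exact hx.1)
    · rw [← hfrontier, gauge_smul_of_nonneg (inv_nonneg.2 hx0.le), smul_eq_mul,
        inv_mul_cancel₀ hx0.ne']
    · simp only [add_sub_cancel_left, smul_inv_smul₀ hx0.ne', add_sub_cancel]

end Frontier

section ChangeOfVariables

/-- The signed area of the parallelogram spanned by two vectors of the plane. -/
def planeDet (x y : Plane) : ℝ := x 0 * y 1 - x 1 * y 0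

theorem planeDet_frame (a b c d φ : ℝ) :
    planeDet (a • N φ + b • N' φ) (c • N φ + d • N' φ) = a * d - b * c := by
  simp only [planeDet, N, N', PiLp.add_apply, PiLp.smul_apply, Matrix.cons_val_zero,
    Matrix.cons_val_one, smul_eq_mul]
  linear_combination (a * d - b * c) * sin_sq_add_cos_sq φ

/-- The linear map with columns `x` and `y`. -/
def ofColumns (x y : Plane) : ℝ × ℝ →L[ℝ] Plane :=
  (ContinuousLinearMap.fst ℝ ℝ ℝ).smulRight x + (ContinuousLinearMap.snd ℝ ℝ ℝ).smulRight y

/-- The Euclidean plane with its two coordinates. -/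
def planeEquiv : Plane ≃L[ℝ] ℝ × ℝ :=
  (EuclideanSpace.equiv (Fin 2) ℝ).trans (ContinuousLinearEquiv.finTwoArrow ℝ ℝ)

theorem measurePreserving_planeEquiv : MeasurePreserving planeEquiv :=
  (volume_preserving_finTwoArrow ℝ).comp (PiLp.volume_preserving_ofLp (Fin 2))

theorem det_planeEquiv_comp_ofColumns (x y : Plane) :
    ((planeEquiv : Plane →L[ℝ] ℝ × ℝ).comp (ofColumns x y)).det = planeDet x y := by
  have h : (planeEquiv : Plane →L[ℝ] ℝ × ℝ).comp (ofColumns x y) =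
      (Matrix.toLin (.finTwoProd ℝ) (.finTwoProd ℝ)
        !![x 0, y 0; x 1, y 1]).toContinuousLinearMap := by
    rw [Matrix.toLin_finTwoProd_toContinuousLinearMap]
    ext <;> simp [planeEquiv, ofColumns]
  rw [h, LinearMap.det_toContinuousLinearMap, LinearMap.det_toLin, Matrix.det_fin_two_of, planeDet]
  ring

variable {S : Set (ℝ × ℝ)} {F : ℝ × ℝ → Plane} {X Y : ℝ × ℝ → Plane}

theorem hasFDerivWithinAt_planeEquiv_comp
    (hF : ∀ q ∈ S, HasFDerivAt F (ofColumns (X q) (Y q)) q) {q : ℝ × ℝ} (hq : q ∈ S) :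
    HasFDerivWithinAt (planeEquiv ∘ F)
      ((planeEquiv : Plane →L[ℝ] ℝ × ℝ).comp (ofColumns (X q) (Y q))) S q :=
  (planeEquiv.hasFDerivAt.comp q (hF q hq)).hasFDerivWithinAt

theorem measurableEmbedding_planeEquiv : MeasurableEmbedding planeEquiv :=
  planeEquiv.toHomeomorph.measurableEmbedding

theorem integral_image_eq_integral_abs_planeDet (hS : MeasurableSet S)
    (hF : ∀ q ∈ S, HasFDerivAt F (ofColumns (X q) (Y q)) q) (hinj : InjOn F S) (g : Plane → ℝ) :
    ∫ x in F '' S, g x = ∫ q in S, |planeDet (X q) (Y q)| * g (F q) := by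
  have h := integral_image_eq_integral_abs_det_fderiv_smul volume hS
    (fun q hq => hasFDerivWithinAt_planeEquiv_comp hF hq) (planeEquiv.injective.comp_injOn hinj)
    (g ∘ planeEquiv.symm)
  rw [image_comp, measurePreserving_planeEquiv.setIntegral_image_emb
    measurableEmbedding_planeEquiv] at h
  simpa only [det_planeEquiv_comp_ofColumns, Function.comp_apply, smul_eq_mul,
    planeEquiv.symm_apply_apply] using h

theorem integrableOn_image_iff_integrableOn_abs_planeDet (hS : MeasurableSet S)
    (hF : ∀ q ∈ S, HasFDerivAt F (ofColumns (X q) (Y q)) q) (hinj : InjOn F S) (g : Plane → ℝ) :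
    IntegrableOn g (F '' S) ↔ IntegrableOn (fun q => |planeDet (X q) (Y q)| * g (F q)) S := by
  have h := integrableOn_image_iff_integrableOn_abs_det_fderiv_smul volume hS
    (fun q hq => hasFDerivWithinAt_planeEquiv_comp hF hq) (planeEquiv.injective.comp_injOn hinj)
    (g ∘ planeEquiv.symm)
  rw [image_comp, measurePreserving_planeEquiv.integrableOn_image
    measurableEmbedding_planeEquiv] at h
  simpa only [det_planeEquiv_comp_ofColumns, Function.comp_def, smul_eq_mul,
    planeEquiv.symm_apply_apply] using h

end ChangeOfVariables

/-- The parametrization of `K` by the segments from the point `c` to the boundary. -/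
def starParam (K : Set Plane) (c : Plane) (q : ℝ × ℝ) : Plane := c + q.1 • (boundaryPt K q.2 - c)

namespace IsStrictlyConvexC2

variable {K : Set Plane}

theorem interior_nonempty (hK : IsStrictlyConvexC2 K) : (interior K).Nonempty := by
  have hnonneg (φ ψ : ℝ) : 0 ≤ supportFrom K (boundaryPt K φ) ψ :=
    hK.mem_iff.1 (hK.boundaryPt_mem φ) ψ
  have heq {φ ψ : ℝ} (h : supportFrom K (boundaryPt K φ) ψ = 0) : boundaryPt K φ = boundaryPt K ψ :=
    hK.eq_boundaryPt (hK.boundaryPt_mem φ) h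
  have hne : boundaryPt K 0 ≠ boundaryPt K π := fun h => pi_ne_zero
    (hK.injOn_boundaryPt ⟨le_rfl, two_pi_pos⟩ ⟨pi_pos.le, by linarith [pi_pos]⟩ h).symm
  refine ⟨(1 / 2 : ℝ) • (boundaryPt K 0 + boundaryPt K π), hK.mem_interior_iff.2 fun ψ => ?_⟩
  have hmid : supportFrom K ((1 / 2 : ℝ) • (boundaryPt K 0 + boundaryPt K π)) ψ =
      (supportFrom K (boundaryPt K 0) ψ + supportFrom K (boundaryPt K π) ψ) / 2 := by
    simp only [supportFrom, real_inner_smul_left, inner_add_left]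
    ring
  rw [hmid]
  rcases (hnonneg 0 ψ).lt_or_eq with h | h
  · linarith [hnonneg π ψ]
  · have : supportFrom K (boundaryPt K π) ψ ≠ 0 := fun h' => hne ((heq h.symm).trans (heq h').symm)
    linarith [(hnonneg π ψ).lt_of_ne' this]

theorem bijOn_starParam (hK : IsStrictlyConvexC2 K) {c : Plane} (hc : c ∈ interior K) :
    BijOn (starParam K c) (Ioc 0 1 ×ˢ Ico 0 (2 * π)) (K \ {c}) := by
  have hγ : BijOn (boundaryPt K) (Ico 0 (2 * π)) (frontier K) :=
    hK.frontier_eq_image ▸ hK.injOn_boundaryPt.bijOn_image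
  exact (bijOn_add_smul_sub_frontier hK.isCompact.isClosed hK.isCompact.isBounded hK.convex hc).comp
    ((bijOn_id _).prodMap hγ)

theorem hasFDerivAt_starParam (hK : IsStrictlyConvexC2 K) (c : Plane) (q : ℝ × ℝ) :
    HasFDerivAt (starParam K c) (ofColumns (boundaryPt K q.2 - c)
      ((q.1 * radius (supportFn K) q.2) • N' q.2)) q := by
  have hγ : HasFDerivAt (fun q : ℝ × ℝ => boundaryPt K q.2 - c) _ q :=
    ((hK.hasDerivAt_boundaryPt q.2).hasFDerivAt.comp q hasFDerivAt_snd).sub_const c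
  refine ((hasFDerivAt_fst.smul hγ).const_add c).congr_fderiv ?_
  ext <;> simp [ofColumns, mul_assoc]

theorem area_eq_integral (hK : IsStrictlyConvexC2 K) {c : Plane} (hc : c ∈ interior K) :
    area K = (1 / 2) * ∫ φ in (0 : ℝ)..2 * π, supportFrom K c φ * radius (supportFn K) φ := by
  have hmeas : MeasurableSet (Ioc (0 : ℝ) 1 ×ˢ Ico 0 (2 * π)) :=
    measurableSet_Ioc.prod measurableSet_Ico
  have hdet (q : ℝ × ℝ) : planeDet (boundaryPt K q.2 - c) ((q.1 * radius (supportFn K) q.2) •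
      N' q.2) = q.1 * (supportFrom K c q.2 * radius (supportFn K) q.2) := by
    have := planeDet_frame (supportFrom K c q.2) (deriv (supportFrom K c) q.2) 0
      (q.1 * radius (supportFn K) q.2) q.2
    rw [hK.boundaryPt_sub]
    simpa [mul_left_comm] using this
  have h := integral_image_eq_integral_abs_planeDet hmeas
    (fun q _ => hK.hasFDerivAt_starParam c q) (hK.bijOn_starParam hc).injOn fun _ => 1
  rw [(hK.bijOn_starParam hc).image_eq, setIntegral_const, smul_eq_mul, mul_one, measureReal_def,
    measure_sdiff_null (measure_singleton _)] at h
  rw [area, h, setIntegral_congr_fun hmeas (g := fun q => q.1 * (supportFrom K c q.2 *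
    radius (supportFn K) q.2)) fun q hq => ?_]
  · rw [Measure.volume_eq_prod, setIntegral_prod_mul (fun s : ℝ => s) fun φ => supportFrom K c φ *
      radius (supportFn K) φ, ← intervalIntegral.integral_of_le zero_le_one,
      integral_Ico_eq_integral_Ioc, ← intervalIntegral.integral_of_le two_pi_pos.le, integral_id]
    norm_num
  · rw [mul_one, hdet, abs_of_pos]
    exact mul_pos hq.1.1 (mul_pos (hK.mem_interior_iff.1 hc _) (hK.radius_pos _))

theorem integral_inner_N_mul_radius (hK : IsStrictlyConvexC2 K) (c : Plane) :
    ∫ φ in (0 : ℝ)..2 * π, inner ℝ c (N φ) * radius (supportFn K) φ = 0 := by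
  have hs := hK.isSupport
  have hρ := hs.continuous_radius
  refine integral_deriv_eq_zero_of_periodic (f := fun φ => inner ℝ c (N φ) * deriv (supportFn K) φ -
    inner ℝ c (N' φ) * supportFn K φ) (fun φ => ?_) ?_ fun φ => ?_
  · convert! ((hasDerivAt_inner_N c φ).mul (hs.hasDerivAt_deriv φ)).sub
      ((hasDerivAt_inner_N' c φ).mul (hs.hasDerivAt φ)) using 1
    rw [radius]
    ring
  · simp only [inner_N]
    fun_prop
  · simp only [periodic_N φ, periodic_N' φ, hs.periodic φ, periodic_deriv hs.periodic φ]

theorem area_eq (hK : IsStrictlyConvexC2 K) : area K = multArea (supportFn K) := by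
  obtain ⟨c, hc⟩ := hK.interior_nonempty
  have hp := hK.isSupport.continuous
  have hρ := hK.isSupport.continuous_radius
  have hN : Continuous fun φ => (inner ℝ c (N φ) : ℝ) := by
    simp only [inner_N]
    fun_prop
  rw [multArea_eq _ hK.contDiff (periodic_supportFn K), hK.area_eq_integral hc]
  simp only [supportFrom, sub_mul]
  rw [integral_sub_of_continuous (hp.fun_mul hρ) (hN.fun_mul hρ), hK.integral_inner_N_mul_radius,
    sub_zero]
  rfl

end IsStrictlyConvexC2

/-- The distance from the point `γ(φ)` to the intersection of the support lines of directions `φ`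
and `φ + τ`, measured along the former. -/
def tangentLen (p : ℝ → ℝ) (φ τ : ℝ) : ℝ := gap p φ τ / sin τ

/-- The density of the area measure in the coordinates `exteriorParam`. -/
def exteriorDensity (p : ℝ → ℝ) (q : ℝ × ℝ) : ℝ :=
  gap p q.1 q.2 * gap p (q.1 + q.2) (-q.2) / sin q.2 ^ 3

/-- The intersection of the support lines of directions `φ` and `φ + τ`, for `q = (φ, τ)`. -/
def exteriorParam (K : Set Plane) (q : ℝ × ℝ) : Plane :=
  boundaryPt K q.1 + tangentLen (supportFn K) q.1 q.2 • N' q.1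

theorem IsSupport.exteriorDensity_pos {p : ℝ → ℝ} (hp : IsSupport p) {q : ℝ × ℝ}
    (hq : q.2 ∈ Ioo 0 π) : 0 < exteriorDensity p q := by
  have hcos := cos_lt_one_of_mem_Ioo hq
  exact div_pos (mul_pos (hp.gap_pos _ hcos) (hp.gap_pos _ (by rwa [cos_neg])))
    (pow_pos (sin_pos_of_mem_Ioo hq) 3)

theorem IsPeriodicC2.hasFDerivAt_tangentLen {p : ℝ → ℝ} (hp : IsPeriodicC2 p) {q : ℝ × ℝ}
    (hq : sin q.2 ≠ 0) :
    HasFDerivAt (fun q : ℝ × ℝ => tangentLen p q.1 q.2)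
      (((deriv p (q.1 + q.2) - deriv p q.1 * cos q.2 - deriv (deriv p) q.1 * sin q.2) / sin q.2) •
          ContinuousLinearMap.fst ℝ ℝ ℝ +
        (gap p (q.1 + q.2) (-q.2) / sin q.2 ^ 2) • ContinuousLinearMap.snd ℝ ℝ ℝ) q := by
  have hfst : HasFDerivAt Prod.fst (ContinuousLinearMap.fst ℝ ℝ ℝ) q := hasFDerivAt_fst
  have hsnd : HasFDerivAt Prod.snd (ContinuousLinearMap.snd ℝ ℝ ℝ) q := hasFDerivAt_snd
  have hgap : HasFDerivAt (fun q : ℝ × ℝ => gap p q.1 q.2) _ q :=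
    (((hp.hasDerivAt (q.1 + q.2)).comp_hasFDerivAt q (hfst.add hsnd)).sub
      (((hp.hasDerivAt q.1).comp_hasFDerivAt q hfst).mul
        ((hasDerivAt_cos q.2).comp_hasFDerivAt q hsnd))).sub
      (((hp.hasDerivAt_deriv q.1).comp_hasFDerivAt q hfst).mul
        ((hasDerivAt_sin q.2).comp_hasFDerivAt q hsnd))
  have hinv := (hasDerivAt_inv hq).comp_hasFDerivAt q
    ((hasDerivAt_sin q.2).comp_hasFDerivAt q hsnd)
  refine (hgap.mul hinv).congr_fderiv ?_
  ext
  · simp only [neg_smul, smul_neg, Function.comp_apply, smul_add, ContinuousLinearMap.add_comp,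
      ContinuousLinearMap.neg_comp, ContinuousLinearMap.smul_comp,
      ContinuousLinearMap.snd_comp_inl, smul_zero, neg_zero, ContinuousLinearMap.sub_comp,
      ContinuousLinearMap.fst_comp_inl, add_zero, zero_add, smul_apply, sub_apply,
      ContinuousLinearMap.id_apply, smul_eq_mul, mul_one]
    field_simp
  · simp only [gap, neg_smul, smul_neg, Function.comp_apply, smul_add,
      ContinuousLinearMap.add_comp, ContinuousLinearMap.neg_comp, ContinuousLinearMap.smul_comp,
      ContinuousLinearMap.snd_comp_inr, ContinuousLinearMap.sub_comp,
      ContinuousLinearMap.fst_comp_inr, smul_zero, zero_add, add_zero, sub_neg_eq_add, add_apply,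
      neg_apply, smul_apply, ContinuousLinearMap.id_apply, smul_eq_mul, mul_one, sub_apply,
      add_neg_cancel_right, cos_neg, sin_neg, mul_neg]
    field_simp
    linear_combination p q.1 * sin_sq_add_cos_sq q.2

theorem supportFrom_exteriorParam (K : Set Plane) (φ τ : ℝ) :
    supportFrom K (exteriorParam K (φ, τ)) φ = 0 := by
  rw [supportFrom, exteriorParam, inner_add_left, real_inner_smul_left, inner_boundaryPt_self,
    inner_N'_N, sub_self, sin_zero]
  ring

theorem supportFrom_exteriorParam_add (K : Set Plane) (φ : ℝ) {τ : ℝ} (hτ : sin τ ≠ 0) :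
    supportFrom K (exteriorParam K (φ, τ)) (φ + τ) = 0 := by
  rw [supportFrom, exteriorParam, inner_add_left, real_inner_smul_left, inner_boundaryPt,
    inner_N'_N, add_sub_cancel_left, tangentLen, div_mul_cancel₀ _ hτ]
  ring

namespace IsStrictlyConvexC2

variable {K : Set Plane}

theorem eq_exteriorParam (hK : IsStrictlyConvexC2 K) {P : Plane} {φ τ : ℝ} (hτ : sin τ ≠ 0)
    (h₀ : supportFrom K P φ = 0) (h₁ : supportFrom K P (φ + τ) = 0) :
    P = exteriorParam K (φ, τ) := by
  have hsub := hK.boundaryPt_sub_of_eq_zero h₀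
  have hinner := congrArg (fun x : Plane => (inner ℝ x (N (φ + τ)) : ℝ)) hsub
  rw [inner_sub_left, inner_boundaryPt, real_inner_smul_left, inner_N'_N, add_sub_cancel_left]
    at hinner
  have hT : tangentLen (supportFn K) φ τ = -deriv (supportFrom K P) φ := by
    rw [tangentLen, div_eq_iff hτ]
    rw [supportFrom] at h₁
    linarith
  rw [exteriorParam, hT, neg_smul, ← hsub]
  abel

theorem bijOn_exteriorParam (hK : IsStrictlyConvexC2 K) :
    BijOn (exteriorParam K) (Ico 0 (2 * π) ×ˢ Ioo 0 π) Kᶜ := by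
  have hmem {P : Plane} : P ∈ Kᶜ ↔ ∃ ψ, supportFrom K P ψ < 0 := by
    rw [mem_compl_iff, hK.mem_iff]
    push Not
    rfl
  refine ⟨?_, ?_, ?_⟩
  · rintro ⟨φ, τ⟩ ⟨-, hτ⟩
    exact hmem.2 ((hK.isSupport_supportFrom _).exists_neg_of_zeros hτ
      (supportFrom_exteriorParam K φ τ)
      (supportFrom_exteriorParam_add K φ (sin_pos_of_mem_Ioo hτ).ne'))
  · rintro ⟨φ, τ⟩ ⟨hφ, hτ⟩ ⟨φ', τ'⟩ ⟨hφ', hτ'⟩ h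
    have h₀ := supportFrom_exteriorParam K φ τ
    have h₁ := supportFrom_exteriorParam_add K φ (sin_pos_of_mem_Ioo hτ).ne'
    rw [h] at h₀ h₁
    obtain ⟨hangle, hτeq⟩ := (hK.isSupport_supportFrom _).zero_pair_unique hτ'
      (supportFrom_exteriorParam K φ' τ')
      (supportFrom_exteriorParam_add K φ' (sin_pos_of_mem_Ioo hτ').ne') hτ h₀ h₁
    exact Prod.ext (eq_of_angle_eq_of_mem_Ico hφ hφ' hangle) hτeq
  · intro P hP
    obtain ⟨ψ, hψ⟩ := hmem.1 hP
    have hs := hK.isSupport_supportFrom P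
    obtain ⟨φ, τ, hτ, h₀, h₁⟩ := hs.exists_zeros_of_neg hψ
    have hper : Function.Periodic (fun φ => (supportFrom K P φ, supportFrom K P (φ + τ))) (2 * π) :=
      fun φ => by simp only [add_right_comm φ, hs.periodic φ, hs.periodic (φ + τ)]
    obtain ⟨χ, hχ, heq⟩ := hper.exists_mem_Ico₀ two_pi_pos φ
    rw [Prod.mk.injEq, h₀, h₁] at heq
    exact ⟨(χ, τ), ⟨hχ, hτ⟩,
      (hK.eq_exteriorParam (sin_pos_of_mem_Ioo hτ).ne' heq.1.symm heq.2.symm).symm⟩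

theorem visualAngle_exteriorParam (hK : IsStrictlyConvexC2 K) {q : ℝ × ℝ} (hq : q.2 ∈ Ioo 0 π) :
    visualAngle K (exteriorParam K q) = π - q.2 :=
  hK.visualAngle_eq hq (supportFrom_exteriorParam K q.1 q.2)
    (supportFrom_exteriorParam_add K q.1 (sin_pos_of_mem_Ioo hq).ne')

theorem exists_hasFDerivAt_exteriorParam (hK : IsStrictlyConvexC2 K) :
    ∃ X Y : ℝ × ℝ → Plane, ∀ q : ℝ × ℝ, q.2 ∈ Ioo 0 π →
      HasFDerivAt (exteriorParam K) (ofColumns (X q) (Y q)) q ∧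
        |planeDet (X q) (Y q)| = exteriorDensity (supportFn K) q := by
  set p := supportFn K
  let T (q : ℝ × ℝ) := tangentLen p q.1 q.2
  let Tφ (q : ℝ × ℝ) :=
    (deriv p (q.1 + q.2) - deriv p q.1 * cos q.2 - deriv (deriv p) q.1 * sin q.2) / sin q.2
  let Tτ (q : ℝ × ℝ) := gap p (q.1 + q.2) (-q.2) / sin q.2 ^ 2
  refine ⟨fun q => (-T q) • N q.1 + (radius p q.1 + Tφ q) • N' q.1,
    fun q => (0 : ℝ) • N q.1 + Tτ q • N' q.1, fun q hq => ⟨?_, ?_⟩⟩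
  · have hT := hK.isSupport.hasFDerivAt_tangentLen (sin_pos_of_mem_Ioo hq).ne'
    have hN' : HasFDerivAt (fun q : ℝ × ℝ => N' q.1) _ q :=
      (hasDerivAt_N' q.1).hasFDerivAt.comp q hasFDerivAt_fst
    have hγ : HasFDerivAt (fun q : ℝ × ℝ => boundaryPt K q.1) _ q :=
      (hK.hasDerivAt_boundaryPt q.1).hasFDerivAt.comp q hasFDerivAt_fst
    refine (hγ.add (hT.smul hN')).congr_fderiv ?_
    ext
    · simp only [ContinuousLinearMap.add_comp, ContinuousLinearMap.smul_comp, add_apply,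
        ContinuousLinearMap.comp_apply, ContinuousLinearMap.inl_apply,
        ContinuousLinearMap.coe_fst', ContinuousLinearMap.toSpanSingleton_apply, one_smul,
        smul_apply, smul_neg, ContinuousLinearMap.smulRight_apply, smul_eq_mul, mul_one,
        ContinuousLinearMap.coe_snd', mul_zero, add_zero, PiLp.add_apply, PiLp.smul_apply,
        PiLp.neg_apply, ofColumns, neg_smul, zero_smul, zero_add, smul_add, T, p, Tφ, Tτ]
      ring
    all_goals simp [ofColumns, T, Tφ, Tτ, p]
  · rw [planeDet_frame, ← abs_of_pos (hK.isSupport.exteriorDensity_pos hq), ← abs_neg]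
    congr 1
    simp only [T, Tτ, tangentLen, exteriorDensity]
    have := (sin_pos_of_mem_Ioo hq).ne'
    field_simp
    ring

theorem integral_visualAngle (hK : IsStrictlyConvexC2 K) (g : ℝ → ℝ) :
    ∫ P in Kᶜ, g (visualAngle K P) = ∫ q in Ico (0 : ℝ) (2 * π) ×ˢ Ioo (0 : ℝ) π,
      exteriorDensity (supportFn K) q * g (π - q.2) := by
  obtain ⟨X, Y, hXY⟩ := hK.exists_hasFDerivAt_exteriorParam
  have hmeas : MeasurableSet (Ico (0 : ℝ) (2 * π) ×ˢ Ioo (0 : ℝ) π) :=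
    measurableSet_Ico.prod measurableSet_Ioo
  rw [← hK.bijOn_exteriorParam.image_eq, integral_image_eq_integral_abs_planeDet hmeas
    (fun q hq => (hXY q hq.2).1) hK.bijOn_exteriorParam.injOn]
  exact setIntegral_congr_fun hmeas fun q hq => by
    simp only [(hXY q hq.2).2, hK.visualAngle_exteriorParam hq.2]

theorem integrableOn_visualAngle_iff (hK : IsStrictlyConvexC2 K) (g : ℝ → ℝ) :
    IntegrableOn (fun P => g (visualAngle K P)) Kᶜ ↔
      IntegrableOn (fun q => exteriorDensity (supportFn K) q * g (π - q.2))
        (Ico 0 (2 * π) ×ˢ Ioo 0 π) := by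
  obtain ⟨X, Y, hXY⟩ := hK.exists_hasFDerivAt_exteriorParam
  have hmeas : MeasurableSet (Ico (0 : ℝ) (2 * π) ×ˢ Ioo (0 : ℝ) π) :=
    measurableSet_Ico.prod measurableSet_Ioo
  rw [← hK.bijOn_exteriorParam.image_eq, integrableOn_image_iff_integrableOn_abs_planeDet hmeas
    (fun q hq => (hXY q hq.2).1) hK.bijOn_exteriorParam.injOn]
  exact integrableOn_congr_fun (fun q hq => by
    simp only [(hXY q hq.2).2, hK.visualAngle_exteriorParam hq.2]) hmeas

end IsStrictlyConvexC2

section PowerSpectrum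

variable {f f' : ℝ → ℝ}

/-- The squared modulus of the `n`-th Fourier coefficient on `[0, 2π]` of a real function. -/
def powerSpec (f : ℝ → ℝ) (n : ℤ) : ℝ := ‖fourierCoeffOn two_pi_pos (fun x => (f x : ℂ)) n‖ ^ 2

theorem powerSpec_nonneg (f : ℝ → ℝ) (n : ℤ) : 0 ≤ powerSpec f n := sq_nonneg _

theorem hasSum_powerSpec (hf : Continuous f) :
    HasSum (powerSpec f) ((2 * π)⁻¹ * ∫ x in (0 : ℝ)..2 * π, f x ^ 2) := by
  have hf' : Continuous fun x => (f x : ℂ) := by fun_prop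
  obtain ⟨C, hC⟩ := (isCompact_Icc (a := 0) (b := 2 * π)).exists_bound_of_continuousOn
    hf'.continuousOn
  have hL2 : MemLp (fun x => (f x : ℂ)) 2 (volume.restrict (Ioc 0 (2 * π))) :=
    MemLp.of_bound hf'.aestronglyMeasurable C ((ae_restrict_mem measurableSet_Ioc).mono
      fun x hx => hC x (Ioc_subset_Icc_self hx))
  have h := hasSum_sq_fourierCoeffOn two_pi_pos hL2
  simp only [Complex.norm_real, Real.norm_eq_abs, sq_abs, sub_zero, smul_eq_mul] at h
  exact h

theorem fourierCoeffOn_ofReal (hf : Continuous f) (n : ℤ) :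
    fourierCoeffOn two_pi_pos (fun x => (f x : ℂ)) n =
      ((2 * π)⁻¹ : ℝ) * (((∫ x in (0 : ℝ)..2 * π, f x * cos (n * x) : ℝ) : ℂ) -
        (∫ x in (0 : ℝ)..2 * π, f x * sin (n * x) : ℝ) * Complex.I) := by
  have hexp (x : ℝ) : 2 * π * Complex.I * ((-n : ℤ) : ℂ) * x / ((2 * π : ℝ) : ℂ) =
      ((-(n * x) : ℝ) : ℂ) * Complex.I := by
    push_cast
    field_simp
  rw [fourierCoeffOn_eq_integral, ← intervalIntegral.integral_ofReal,
    ← intervalIntegral.integral_ofReal, ← intervalIntegral.integral_mul_const,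
    ← intervalIntegral.integral_sub (Continuous.intervalIntegrable (by fun_prop) _ _)
      (Continuous.intervalIntegrable (by fun_prop) _ _), Complex.real_smul, sub_zero, one_div]
  congr 1
  refine intervalIntegral.integral_congr fun x _ => ?_
  simp only [fourier_coe_apply, hexp, Complex.exp_mul_I, ← Complex.ofReal_cos,
    ← Complex.ofReal_sin, cos_neg, sin_neg, smul_eq_mul]
  push_cast
  ring

theorem powerSpec_eq (hf : Continuous f) (n : ℤ) :
    powerSpec f n = ((∫ x in (0 : ℝ)..2 * π, f x * cos (n * x)) ^ 2 +
      (∫ x in (0 : ℝ)..2 * π, f x * sin (n * x)) ^ 2) / (4 * π ^ 2) := by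
  rw [powerSpec, fourierCoeffOn_ofReal hf, norm_mul, mul_pow, Complex.norm_real, Real.norm_eq_abs,
    sq_abs, sub_eq_add_neg, ← neg_mul, ← Complex.ofReal_neg, ← Complex.normSq_eq_norm_sq,
    Complex.normSq_add_mul_I]
  field_simp
  ring

theorem powerSpec_neg (hf : Continuous f) (n : ℤ) : powerSpec f (-n) = powerSpec f n := by
  simp only [powerSpec_eq hf, Int.cast_neg, neg_mul, cos_neg, sin_neg, mul_neg,
    intervalIntegral.integral_neg, neg_sq]

theorem powerSpec_deriv (hd : ∀ x, HasDerivAt f (f' x) x) (hf' : Continuous f')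
    (hper : Function.Periodic f (2 * π)) (n : ℤ) : powerSpec f' n = n ^ 2 * powerSpec f n := by
  rcases eq_or_ne n 0 with rfl | hn
  · simp [powerSpec_eq hf', integral_deriv_eq_zero_of_periodic hd hf' hper]
  · have h := fourierCoeffOn_of_hasDerivAt two_pi_pos hn (f := fun x => (f x : ℂ))
      (f' := fun x => (f' x : ℂ)) (fun x _ => (hd x).ofReal_comp)
      (Continuous.intervalIntegrable (by fun_prop) _ _)
    rw [hper.eq, sub_self, mul_zero, zero_sub] at h
    have hn' : |(n : ℝ)| ≠ 0 := by simpa using hn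
    rw [powerSpec, powerSpec, h]
    simp only [neg_mul, one_div, inv_neg, mul_inv_rev, Complex.inv_I, mul_neg, neg_neg,
      Complex.ofReal_mul, Complex.ofReal_ofNat, Complex.ofReal_zero, sub_zero, norm_neg,
      Complex.norm_mul, norm_inv, Complex.norm_intCast, Complex.norm_I, Complex.norm_real,
      norm_eq_abs, abs_of_pos pi_pos, Complex.norm_ofNat, one_mul]
    field_simp
    rw [sq_abs]

theorem hasSum_multArea (hd : ∀ x, HasDerivAt f (deriv f x) x) (hf' : Continuous (deriv f))
    (hper : Function.Periodic f (2 * π)) :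
    HasSum (fun n : ℤ => π * (1 - n ^ 2) * powerSpec f n) (multArea f) := by
  have hf : Continuous f := continuous_iff_continuousAt.2 fun x => (hd x).continuousAt
  have h := ((hasSum_powerSpec hf).sub (hasSum_powerSpec hf')).mul_left π
  have heq : multArea f = π * ((2 * π)⁻¹ * (∫ x in (0 : ℝ)..2 * π, f x ^ 2) -
      (2 * π)⁻¹ * ∫ x in (0 : ℝ)..2 * π, deriv f x ^ 2) := by
    rw [multArea, integral_sub_of_continuous (by fun_prop) (by fun_prop)]
    field_simp
  rw [heq]
  refine h.congr_fun fun n => ?_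
  rw [powerSpec_deriv hd hf' hper]
  ring

end PowerSpectrum

section Correlation

variable {u v v' : ℝ → ℝ}

/-- The correlation of two functions over a period. -/
def corr (u v : ℝ → ℝ) (τ : ℝ) : ℝ := ∫ φ in (0 : ℝ)..2 * π, u φ * v (φ + τ)

theorem continuous_corr (hu : Continuous u) (hv : Continuous v) : Continuous (corr u v) :=
  intervalIntegral.continuous_parametric_intervalIntegral_of_continuous' (by fun_prop) _ _

theorem hasDerivAt_corr (hu : Continuous u) (hv' : Continuous v')
    (hd : ∀ x, HasDerivAt v (v' x) x) (τ : ℝ) : HasDerivAt (corr u v) (corr u v' τ) τ := by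
  have hv : Continuous v := continuous_iff_continuousAt.2 fun x => (hd x).continuousAt
  obtain ⟨C, hC⟩ := (isCompact_Icc (a := τ - 1) (b := τ + 1 + 2 * π)).exists_bound_of_continuousOn
    hv'.continuousOn
  refine (intervalIntegral.hasDerivAt_integral_of_dominated_loc_of_deriv_le
    (F := fun τ φ => u φ * v (φ + τ))
    (F' := fun τ φ => u φ * v' (φ + τ)) (bound := fun φ => |u φ| * C)
    (Metric.ball_mem_nhds τ one_pos)
    (Eventually.of_forall fun x => (Continuous.aestronglyMeasurable (by fun_prop)))
    (Continuous.intervalIntegrable (by fun_prop) _ _)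
    (Continuous.aestronglyMeasurable (by fun_prop)) (Eventually.of_forall fun t ht x hx => ?_)
    (Continuous.intervalIntegrable (by fun_prop) _ _)
    (Eventually.of_forall fun t _ x _ => ((hd (t + x)).comp_const_add t x).const_mul (u t))).2
  rw [uIoc_of_le two_pi_pos.le] at ht
  rw [Metric.mem_ball, Real.dist_eq, abs_lt] at hx
  rw [norm_mul, Real.norm_eq_abs]
  exact mul_le_mul_of_nonneg_left (hC _ ⟨by linarith [ht.1, hx.1], by linarith [ht.2, hx.2]⟩)
    (abs_nonneg _)

theorem corr_add_two_pi (hv : Function.Periodic v (2 * π)) (τ : ℝ) :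
    corr u v (τ + 2 * π) = corr u v τ := by
  simp only [corr, ← add_assoc, hv _]

theorem corr_neg (hu : Function.Periodic u (2 * π)) (hv : Function.Periodic v (2 * π)) (τ : ℝ) :
    corr u v (-τ) = corr v u τ := by
  have hper : Function.Periodic (fun φ => v φ * u (φ + τ)) (2 * π) := fun φ => by
    simp only [add_right_comm φ (2 * π) τ, hv _, hu _]
  rw [corr, corr, ← integral_comp_add_of_periodic hper (-τ)]
  simp only [neg_add_cancel_right, mul_comm]

theorem corr_deriv_left {u' : ℝ → ℝ} (hu : ∀ x, HasDerivAt u (u' x) x)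
    (hv : ∀ x, HasDerivAt v (v' x) x) (hu' : Continuous u') (hv' : Continuous v')
    (hup : Function.Periodic u (2 * π)) (hvp : Function.Periodic v (2 * π)) (τ : ℝ) :
    corr u' v τ = -corr u v' τ := by
  have huc : Continuous u := continuous_iff_continuousAt.2 fun x => (hu x).continuousAt
  have hvc : Continuous v := continuous_iff_continuousAt.2 fun x => (hv x).continuousAt
  have h := integral_deriv_eq_zero_of_periodic (T := 2 * π)
    (fun x => (hu x).mul ((hv (x + τ)).comp_add_const x τ)) (by fun_prop)
    (fun x => by simp only [Pi.mul_apply, add_right_comm x (2 * π) τ, hup _, hvp _])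
  rw [integral_add_of_continuous (by fun_prop) (by fun_prop)] at h
  exact eq_neg_of_add_eq_zero_left h

theorem integral_corr_mul {w : ℝ → ℝ} (hu : Continuous u) (hv : Continuous v) (hw : Continuous w)
    (hvp : Function.Periodic v (2 * π)) (hwp : Function.Periodic w (2 * π)) :
    ∫ τ in (0 : ℝ)..2 * π, corr u v τ * w τ =
      ∫ φ in (0 : ℝ)..2 * π, u φ * ∫ ψ in (0 : ℝ)..2 * π, v ψ * w (ψ - φ) := by
  have hinner (φ : ℝ) : ∫ τ in (0 : ℝ)..2 * π, u φ * v (φ + τ) * w τ =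
      u φ * ∫ ψ in (0 : ℝ)..2 * π, v ψ * w (ψ - φ) := by
    have hper : Function.Periodic (fun ψ => v ψ * w (ψ - φ)) (2 * π) := fun ψ => by
      simp only [add_sub_right_comm ψ (2 * π) φ, hvp _, hwp _]
    rw [← integral_comp_add_of_periodic hper φ, ← intervalIntegral.integral_const_mul]
    simp only [add_sub_cancel_right, add_comm φ, mul_assoc]
  simp only [← hinner, corr, ← intervalIntegral.integral_mul_const]
  refine intervalIntegral_intervalIntegral_swap ?_
  rw [uIoc_of_le two_pi_pos.le]
  exact ((Continuous.continuousOn (by fun_prop)).integrableOn_compact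
    (isCompact_Icc.prod isCompact_Icc)).mono_set
      (prod_mono Ioc_subset_Icc_self Ioc_subset_Icc_self)

theorem integral_half_period_of_even {f : ℝ → ℝ} (hf : Continuous f)
    (hper : Function.Periodic f (2 * π)) (heven : ∀ x, f (-x) = f x) :
    ∫ x in (0 : ℝ)..π, f x = (1 / 2) * ∫ x in (0 : ℝ)..2 * π, f x := by
  have hreflect : ∫ x in π..2 * π, f x = ∫ x in (0 : ℝ)..π, f x := by
    have h := intervalIntegral.integral_comp_sub_left (a := (0 : ℝ)) (b := π) f (2 * π)
    rw [show 2 * π - π = π by ring, sub_zero] at h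
    simp only [← h, sub_eq_neg_add, hper _, heven]
  rw [← intervalIntegral.integral_add_adjacent_intervals (hf.intervalIntegrable 0 π)
    (hf.intervalIntegrable π (2 * π)), hreflect]
  ring

theorem integral_corr_mul_cos (hu : Continuous u) (hup : Function.Periodic u (2 * π)) (n : ℤ) :
    ∫ τ in (0 : ℝ)..π, corr u u τ * cos (n * τ) = 2 * π ^ 2 * powerSpec u n := by
  have hcorr := continuous_corr hu hu
  have hcos : Function.Periodic (fun τ => cos (n * τ)) (2 * π) := fun τ => by
    simp only [mul_add, cos_add_int_mul_two_pi]
  have hinner (φ : ℝ) : ∫ ψ in (0 : ℝ)..2 * π, u ψ * cos (n * (ψ - φ)) =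
      cos (n * φ) * (∫ ψ in (0 : ℝ)..2 * π, u ψ * cos (n * ψ)) +
        sin (n * φ) * ∫ ψ in (0 : ℝ)..2 * π, u ψ * sin (n * ψ) := by
    rw [← intervalIntegral.integral_const_mul, ← intervalIntegral.integral_const_mul,
      ← integral_add_of_continuous (by fun_prop) (by fun_prop)]
    refine intervalIntegral.integral_congr fun ψ _ => ?_
    simp only [mul_sub, cos_sub]
    ring
  rw [integral_half_period_of_even (by fun_prop) (fun τ => ?_) fun τ => ?_,
    integral_corr_mul hu hu (by fun_prop) hup hcos, powerSpec_eq hu]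
  · simp only [hinner, mul_add, ← mul_assoc]
    rw [integral_add_of_continuous (by fun_prop) (by fun_prop),
      intervalIntegral.integral_mul_const, intervalIntegral.integral_mul_const]
    field_simp
    ring
  · simp only [corr_add_two_pi hup, hcos τ]
  · simp only [corr_neg hup hup, mul_neg, cos_neg]

end Correlation

theorem integral_comp_add_mul_comp_add {u v : ℝ → ℝ} (hu : Function.Periodic u (2 * π))
    (hv : Function.Periodic v (2 * π)) (τ τ' : ℝ) :
    ∫ φ in (0 : ℝ)..2 * π, u (φ + τ) * v (φ + τ + τ') = corr u v τ' := by
  have hper : Function.Periodic (fun φ => u φ * v (φ + τ')) (2 * π) := fun φ => by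
    simp only [add_right_comm φ (2 * π) τ', hu _, hv _]
  exact integral_comp_add_of_periodic hper τ

/-- The integral over a period of the product of the distances from `γ(φ)` to the tangent at
`φ + τ` and from `γ(φ + τ)` to the tangent at `φ`, the factor of the exterior density that depends
on the curve. -/
def gapCorr (p : ℝ → ℝ) (τ : ℝ) : ℝ :=
  ∫ φ in (0 : ℝ)..2 * π, gap p φ τ * gap p (φ + τ) (-τ)

/-- The integral over a period of the squared distance from `γ(φ)` to the tangent at `φ + τ`. -/
def gapEnergy (p : ℝ → ℝ) (τ : ℝ) : ℝ := ∫ φ in (0 : ℝ)..2 * π, gap p φ τ ^ 2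

namespace IsPeriodicC2

variable {p : ℝ → ℝ}

theorem hasDerivAt_corr_self (hp : IsPeriodicC2 p) (τ : ℝ) :
    HasDerivAt (corr p p) (corr p (deriv p) τ) τ :=
  hasDerivAt_corr hp.continuous hp.continuous_deriv hp.hasDerivAt τ

theorem hasDerivAt_corr_deriv (hp : IsPeriodicC2 p) (τ : ℝ) :
    HasDerivAt (corr p (deriv p)) (corr p (deriv (deriv p)) τ) τ :=
  hasDerivAt_corr hp.continuous hp.continuous_deriv2 hp.hasDerivAt_deriv τ

theorem corr_deriv_self (hp : IsPeriodicC2 p) (τ : ℝ) :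
    corr (deriv p) p τ = -corr p (deriv p) τ :=
  corr_deriv_left hp.hasDerivAt hp.hasDerivAt hp.continuous_deriv hp.continuous_deriv hp.periodic
    hp.periodic τ

theorem corr_deriv_deriv (hp : IsPeriodicC2 p) (τ : ℝ) :
    corr (deriv p) (deriv p) τ = -corr p (deriv (deriv p)) τ :=
  corr_deriv_left hp.hasDerivAt hp.hasDerivAt_deriv hp.continuous_deriv hp.continuous_deriv2
    hp.periodic (periodic_deriv hp.periodic) τ

theorem corr_self_deriv_zero (hp : IsPeriodicC2 p) : corr p (deriv p) 0 = 0 := by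
  have h := hp.corr_deriv_self 0
  rw [← corr_neg hp.periodic (periodic_deriv hp.periodic), neg_zero] at h
  linarith

theorem multArea_eq_corr (hp : IsPeriodicC2 p) :
    multArea p = (1 / 2) * (corr p p 0 + corr p (deriv (deriv p)) 0) := by
  have h := hp.corr_deriv_deriv 0
  have := hp.continuous
  have := hp.continuous_deriv
  simp only [corr, add_zero, ← sq] at h ⊢
  rw [multArea, integral_sub_of_continuous (by fun_prop) (by fun_prop), h, sub_neg_eq_add]

theorem gapCorr_eq (hp : IsPeriodicC2 p) (τ : ℝ) :
    gapCorr p τ = (1 + cos τ ^ 2) * corr p p τ - 2 * cos τ * corr p p 0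
      - 2 * cos τ * sin τ * corr p (deriv p) τ + sin τ ^ 2 * corr p (deriv (deriv p)) τ := by
  have h₀ := hp.continuous
  have h₁ := hp.continuous_deriv
  have hexpand (φ : ℝ) : gap p φ τ * gap p (φ + τ) (-τ) =
      (1 + cos τ ^ 2) * (p φ * p (φ + τ))
        - cos τ * (p (φ + τ) * p (φ + τ + 0) + p φ * p (φ + 0))
        + sin τ * (p (φ + τ) * deriv p (φ + τ + 0) - p φ * deriv p (φ + 0))
        + cos τ * sin τ * (deriv p φ * p (φ + τ) - p φ * deriv p (φ + τ))
        - sin τ ^ 2 * (deriv p φ * deriv p (φ + τ)) := by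
    simp only [gap, cos_neg, sin_neg, add_neg_cancel_right, add_zero]
    ring
  simp (disch := fun_prop) only [gapCorr, hexpand, integral_add_of_continuous,
    integral_sub_of_continuous, intervalIntegral.integral_const_mul, ← corr.eq_1,
    integral_comp_add_mul_comp_add hp.periodic hp.periodic,
    integral_comp_add_mul_comp_add hp.periodic (periodic_deriv hp.periodic)]
  rw [hp.corr_deriv_self, hp.corr_deriv_deriv]
  ring

theorem gapEnergy_eq (hp : IsPeriodicC2 p) (τ : ℝ) :
    gapEnergy p τ = (1 + cos τ ^ 2) * corr p p 0 - sin τ ^ 2 * corr p (deriv (deriv p)) 0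
      - 2 * cos τ * corr p p τ + 2 * sin τ * corr p (deriv p) τ := by
  have h₀ := hp.continuous
  have h₁ := hp.continuous_deriv
  have hexpand (φ : ℝ) : gap p φ τ ^ 2 =
      p (φ + τ) * p (φ + τ + 0) + cos τ ^ 2 * (p φ * p (φ + 0))
        + sin τ ^ 2 * (deriv p φ * deriv p (φ + 0)) - 2 * cos τ * (p φ * p (φ + τ))
        - 2 * sin τ * (deriv p φ * p (φ + τ))
        + 2 * cos τ * sin τ * (p φ * deriv p (φ + 0)) := by
    simp only [gap, add_zero]
    ring
  simp (disch := fun_prop) only [gapEnergy, hexpand, integral_add_of_continuous,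
    integral_sub_of_continuous, intervalIntegral.integral_const_mul, ← corr.eq_1,
    integral_comp_add_mul_comp_add hp.periodic hp.periodic]
  rw [hp.corr_deriv_self, hp.corr_deriv_deriv, hp.corr_self_deriv_zero]
  ring

theorem gapCorr_eq_sub (hp : IsPeriodicC2 p) (τ : ℝ) :
    gapCorr p τ = sin τ ^ 2 * (corr p p τ + corr p (deriv (deriv p)) τ - 2 * cos τ * multArea p) -
      cos τ * gapEnergy p τ := by
  rw [hp.gapCorr_eq, hp.gapEnergy_eq, hp.multArea_eq_corr]
  linear_combination (cos τ * corr p p 0 - corr p p τ) * sin_sq_add_cos_sq τ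

theorem hasDerivAt_gapEnergy (hp : IsPeriodicC2 p) (τ : ℝ) :
    HasDerivAt (gapEnergy p)
      (2 * sin τ * (corr p p τ + corr p (deriv (deriv p)) τ - 2 * cos τ * multArea p)) τ := by
  have hsin := hasDerivAt_sin τ
  have hcos := hasDerivAt_cos τ
  rw [funext hp.gapEnergy_eq, hp.multArea_eq_corr]
  convert! ((((hcos.pow 2).const_add 1).mul_const (corr p p 0)).sub
    ((hsin.pow 2).mul_const (corr p (deriv (deriv p)) 0))).sub
    ((hcos.const_mul 2).mul (hp.hasDerivAt_corr_self τ)) |>.add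
    ((hsin.const_mul 2).mul (hp.hasDerivAt_corr_deriv τ)) using 1
  simp only [Nat.cast_ofNat, Nat.add_one_sub_one, pow_one]
  ring

end IsPeriodicC2

section Trigonometry

variable {x τ : ℝ}

theorem sub_sin_mem_Icc (hx : 0 ≤ x) : x - sin x ∈ Icc 0 (x ^ 3) := by
  rcases hx.eq_or_lt with rfl | h
  · simp
  · have := sin_gt_sub_cube h
    have := pow_pos h 3
    exact ⟨by linarith [sin_lt h], by linarith⟩

theorem abs_sub_sin_le (hx : 0 ≤ x) : |x - sin x| ≤ x ^ 3 := by
  obtain ⟨h₀, h⟩ := sub_sin_mem_Icc hx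
  rwa [abs_of_nonneg h₀]

theorem abs_sin_cube_le (hx : 0 ≤ x) : |sin x ^ 3| ≤ x ^ 3 := by
  rw [abs_pow]
  exact pow_le_pow_left₀ (abs_nonneg _) (abs_sin_le_abs.trans_eq (abs_of_nonneg hx)) 3

theorem one_sub_cos_eq (τ : ℝ) : 1 - cos τ = 2 * sin (τ / 2) ^ 2 := by
  rw [← mul_div_cancel₀ τ two_ne_zero, cos_two_mul, mul_div_cancel₀ τ two_ne_zero, cos_sq']
  ring

theorem one_add_cos_eq (τ : ℝ) : 1 + cos τ = 2 * cos (τ / 2) ^ 2 := by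
  rw [← mul_div_cancel₀ τ two_ne_zero, cos_two_mul, mul_div_cancel₀ τ two_ne_zero]
  ring

theorem pi_sub_le_pi_mul_cos_half (h₀ : 0 ≤ τ) (h : τ ≤ π) : π - τ ≤ π * cos (τ / 2) := by
  have hjordan := mul_le_sin (x := π / 2 - τ / 2) (by linarith) (by linarith)
  rw [sin_pi_div_two_sub] at hjordan
  calc π - τ = π * (2 / π * (π / 2 - τ / 2)) := by field_simp
    _ ≤ _ := by gcongr

/-- The factor by which `gapEnergy` is multiplied in the antiderivative of Crofton's integral. -/
def croftonKernel (τ : ℝ) : ℝ := (π - τ - sin τ) / sin τ ^ 2 - sin τ / (1 - cos τ)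

theorem hasDerivAt_croftonKernel (hτ : τ ∈ Ioo 0 π) :
    HasDerivAt croftonKernel (-2 * cos τ * (π - τ - sin τ) / sin τ ^ 3) τ := by
  have hs := (sin_pos_of_mem_Ioo hτ).ne'
  have hc := (sub_pos.2 (cos_lt_one_of_mem_Ioo hτ)).ne'
  have hsin := hasDerivAt_sin τ
  convert! ((((hasDerivAt_id τ).const_sub π).sub hsin).div (hsin.pow 2) (pow_ne_zero 2 hs)).sub
    (hsin.div ((hasDerivAt_cos τ).const_sub 1) hc) using 1
  have hquot : (cos τ * (1 - cos τ) - sin τ * - -sin τ) / (1 - cos τ) ^ 2 =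
      -(1 + cos τ) / sin τ ^ 2 := by
    rw [div_eq_div_iff (pow_ne_zero 2 hc) (pow_ne_zero 2 hs)]
    linear_combination (cos τ - 1 - sin τ ^ 2) * sin_sq_add_cos_sq τ
  rw [hquot]
  simp only [Pi.pow_apply, Pi.sub_apply, id_eq, Nat.cast_ofNat, Nat.add_one_sub_one, pow_one]
  field_simp
  ring

theorem abs_croftonKernel_le (hτ : τ ∈ Ioo 0 π) :
    (1 - cos τ) ^ 2 * |croftonKernel τ| ≤ (1 - cos τ) * ((π - τ) * (π ^ 2 / 2) + sin τ) := by
  have hs := sin_pos_of_mem_Ioo hτ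
  have hω : 0 < π - τ := sub_pos.2 hτ.2
  have hminus : 0 < 1 - cos τ := sub_pos.2 (cos_lt_one_of_mem_Ioo hτ)
  have hprod : (1 - cos τ) * (1 + cos τ) = sin τ ^ 2 := by
    linear_combination -sin_sq_add_cos_sq τ
  have hplus : 0 < 1 + cos τ := pos_of_mul_pos_right (by rw [hprod]; positivity) hminus.le
  obtain ⟨hnum, hcube⟩ := sub_sin_mem_Icc hω.le
  rw [sin_pi_sub] at hnum hcube
  have hquot : (π - τ - sin τ) / (1 + cos τ) ≤ (π - τ) * (π ^ 2 / 2) := by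
    rw [div_le_iff₀ hplus, one_add_cos_eq]
    calc π - τ - sin τ ≤ (π - τ) * (π - τ) ^ 2 := by linarith
      _ ≤ (π - τ) * (π * cos (τ / 2)) ^ 2 := by
        gcongr
        exact pi_sub_le_pi_mul_cos_half hτ.1.le hτ.2.le
      _ = _ := by ring
  calc (1 - cos τ) ^ 2 * |croftonKernel τ|
      ≤ (1 - cos τ) ^ 2 * ((π - τ - sin τ) / sin τ ^ 2 + sin τ / (1 - cos τ)) := by
        gcongr
        refine (abs_sub _ _).trans_eq ?_
        rw [abs_of_nonneg (by positivity), abs_of_nonneg (by positivity)]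
    _ = (1 - cos τ) * ((π - τ - sin τ) / (1 + cos τ) + sin τ) := by
        rw [← hprod]
        field_simp
    _ ≤ _ := by gcongr

end Trigonometry

namespace IsPeriodicC2

variable {p g : ℝ → ℝ}

theorem exists_abs_exteriorDensity_mul_le (hp : IsPeriodicC2 p) :
    ∃ C, ∀ φ, ∀ τ ∈ Ioo 0 π, |exteriorDensity p (φ, τ)| * (π - τ) ^ 3 ≤ C := by
  obtain ⟨C, hC, hgap⟩ := hp.exists_abs_gap_le
  refine ⟨C ^ 2 * π ^ 3 / 2, fun φ τ hτ => ?_⟩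
  have hs := sin_pos_of_mem_Ioo hτ
  have hsin_half : 0 < sin (τ / 2) :=
    sin_pos_of_pos_of_lt_pi (by linarith [hτ.1]) (by linarith [hτ.2, pi_pos])
  have hcos_half : 0 < cos (τ / 2) :=
    cos_pos_of_mem_Ioo ⟨by linarith [hτ.1, pi_pos], by linarith [hτ.2]⟩
  have hω : 0 < π - τ := sub_pos.2 hτ.2
  have hcos : 0 ≤ 1 - cos τ := sub_nonneg.2 (cos_le_one τ)
  have hgap' := hgap (φ + τ) (-τ)
  rw [cos_neg] at hgap'
  calc |exteriorDensity p (φ, τ)| * (π - τ) ^ 3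
      = |gap p φ τ| * |gap p (φ + τ) (-τ)| / sin τ ^ 3 * (π - τ) ^ 3 := by
        rw [exteriorDensity, abs_div, abs_mul, abs_of_pos (pow_pos hs 3)]
    _ ≤ (C * (1 - cos τ)) * (C * (1 - cos τ)) / sin τ ^ 3 * (π * cos (τ / 2)) ^ 3 := by
        gcongr
        · exact hgap φ τ
        · exact pi_sub_le_pi_mul_cos_half hτ.1.le hτ.2.le
    _ = C ^ 2 * π ^ 3 / 2 * sin (τ / 2) := by
        rw [← mul_div_cancel₀ τ two_ne_zero, sin_two_mul, mul_div_cancel₀ τ two_ne_zero,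
          one_sub_cos_eq]
        field_simp
    _ ≤ C ^ 2 * π ^ 3 / 2 := mul_le_of_le_one_right (by positivity) (sin_le_one _)

theorem integrableOn_exteriorDensity_mul (hp : IsPeriodicC2 p) (hg : Continuous g)
    (hg' : ∀ ω ∈ Ioo 0 π, |g ω| ≤ ω ^ 3) :
    IntegrableOn (fun q => exteriorDensity p q * g (π - q.2)) (Ico 0 (2 * π) ×ˢ Ioo 0 π) := by
  obtain ⟨C, hC⟩ := hp.exists_abs_exteriorDensity_mul_le
  have hmeas : MeasurableSet (Ico (0 : ℝ) (2 * π) ×ˢ Ioo (0 : ℝ) π) :=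
    measurableSet_Ico.prod measurableSet_Ioo
  have := hp.continuous
  have := hp.continuous_deriv
  refine IntegrableOn.of_bound ?_ (ContinuousOn.aestronglyMeasurable ?_ hmeas) C
    ((ae_restrict_mem hmeas).mono fun q hq => ?_)
  · rw [Measure.volume_eq_prod, Measure.prod_prod, volume_Ico, volume_Ioo]
    exact ENNReal.mul_lt_top ENNReal.ofReal_lt_top ENNReal.ofReal_lt_top
  · unfold exteriorDensity gap
    exact .mul (.div (by fun_prop) (by fun_prop) fun q hq =>
      pow_ne_zero _ (sin_pos_of_mem_Ioo hq.2).ne') (by fun_prop)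
  · rw [norm_mul, Real.norm_eq_abs, Real.norm_eq_abs]
    exact (mul_le_mul_of_nonneg_left (hg' _ ⟨by linarith [hq.2.2], by linarith [hq.2.1]⟩)
      (abs_nonneg _)).trans (hC q.1 q.2 hq.2)

theorem setIntegral_exteriorDensity_mul (p g : ℝ → ℝ) (τ : ℝ) :
    ∫ φ in Ico 0 (2 * π), exteriorDensity p (φ, τ) * g (π - τ) =
      gapCorr p τ / sin τ ^ 3 * g (π - τ) := by
  rw [integral_Ico_eq_integral_Ioc, ← intervalIntegral.integral_of_le two_pi_pos.le,
    intervalIntegral.integral_mul_const]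
  simp only [exteriorDensity, gapCorr, intervalIntegral.integral_div]

theorem intervalIntegrable_gapCorr_mul (hp : IsPeriodicC2 p) (hg : Continuous g)
    (hg' : ∀ ω ∈ Ioo 0 π, |g ω| ≤ ω ^ 3) :
    IntervalIntegrable (fun τ => gapCorr p τ / sin τ ^ 3 * g (π - τ)) volume 0 π := by
  have hint := hp.integrableOn_exteriorDensity_mul hg hg'
  rw [IntegrableOn, Measure.volume_eq_prod, ← Measure.prod_restrict] at hint
  rw [intervalIntegrable_iff_integrableOn_Ioo_of_le pi_pos.le]
  simpa only [setIntegral_exteriorDensity_mul, IntegrableOn] using hint.integral_prod_right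

theorem integral_exteriorDensity_mul (hp : IsPeriodicC2 p) (hg : Continuous g)
    (hg' : ∀ ω ∈ Ioo 0 π, |g ω| ≤ ω ^ 3) :
    ∫ q in Ico (0 : ℝ) (2 * π) ×ˢ Ioo (0 : ℝ) π, exteriorDensity p q * g (π - q.2) =
      ∫ τ in (0 : ℝ)..π, gapCorr p τ / sin τ ^ 3 * g (π - τ) := by
  have hint := hp.integrableOn_exteriorDensity_mul hg hg'
  rw [IntegrableOn, Measure.volume_eq_prod, ← Measure.prod_restrict] at hint
  rw [Measure.volume_eq_prod, ← Measure.prod_restrict, integral_prod_symm _ hint]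
  simp only [setIntegral_exteriorDensity_mul]
  rw [intervalIntegral.integral_of_le pi_pos.le, integral_Ioc_eq_integral_Ioo]

theorem integral_corr_self (hp : IsPeriodicC2 p) :
    ∫ τ in (0 : ℝ)..π, corr p p τ = 2 * π ^ 2 * powerSpec p 0 := by
  simpa using integral_corr_mul_cos hp.continuous hp.periodic 0

theorem integral_gapCorr (hp : IsPeriodicC2 p) :
    ∫ τ in (0 : ℝ)..π, gapCorr p τ = 3 * π ^ 2 * powerSpec p 0 + 9 * π ^ 2 * powerSpec p 2 := by
  have := continuous_corr hp.continuous hp.continuous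
  have := continuous_corr hp.continuous hp.continuous_deriv
  have := continuous_corr hp.continuous hp.continuous_deriv2
  set D := fun τ => sin τ ^ 2 * corr p (deriv (deriv p)) τ - 2 * sin τ * cos τ * corr p (deriv p) τ
    - 4 * cos (2 * τ) * corr p p τ - 2 * corr p p 0 * cos τ with hD
  have hdecomp (τ : ℝ) : gapCorr p τ =
      3 / 2 * corr p p τ + 9 / 2 * (corr p p τ * cos ((2 : ℤ) * τ)) + D τ := by
    simp only [hp.gapCorr_eq, hD, Int.cast_ofNat, cos_two_mul]
    ring
  have hderiv : ∀ τ, HasDerivAt (fun τ => sin τ ^ 2 * corr p (deriv p) τ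
      - 2 * (sin (2 * τ) * corr p p τ) - 2 * corr p p 0 * sin τ) (D τ) τ := fun τ => by
    have hsin := hasDerivAt_sin τ
    convert! (((hsin.pow 2).mul (hp.hasDerivAt_corr_deriv τ)).sub
      ((((hasDerivAt_id τ).const_mul 2).sin.mul (hp.hasDerivAt_corr_self τ)).const_mul 2)).sub
      (hsin.const_mul (2 * corr p p 0)) using 1
    simp only [hD, sin_two_mul, id_eq, Nat.cast_ofNat, Nat.add_one_sub_one, pow_one, Pi.pow_apply]
    ring
  have hD_zero : ∫ τ in (0 : ℝ)..π, D τ = 0 := by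
    rw [intervalIntegral.integral_eq_sub_of_hasDerivAt (fun τ _ => hderiv τ)
      (Continuous.intervalIntegrable (by fun_prop) _ _)]
    simp
  simp (disch := fun_prop) only [hdecomp, integral_add_of_continuous,
    intervalIntegral.integral_const_mul, hp.integral_corr_self, hD_zero,
    integral_corr_mul_cos hp.continuous hp.periodic]
  ring

theorem integral_gapCorr_mul_sin_cube (hp : IsPeriodicC2 p) :
    ∫ τ in (0 : ℝ)..π, gapCorr p τ / sin τ ^ 3 * sin (π - τ) ^ 3 =
      3 * π ^ 2 * powerSpec p 0 + 9 * π ^ 2 * powerSpec p 2 := by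
  rw [← hp.integral_gapCorr, intervalIntegral.integral_of_le pi_pos.le,
    intervalIntegral.integral_of_le pi_pos.le, integral_Ioc_eq_integral_Ioo,
    integral_Ioc_eq_integral_Ioo]
  refine setIntegral_congr_fun measurableSet_Ioo fun τ hτ => ?_
  rw [sin_pi_sub, div_mul_cancel₀ _ (pow_pos (sin_pos_of_mem_Ioo hτ) 3).ne']

/-- The difference between Crofton's integrand and an exact derivative. -/
def croftonRemainder (p : ℝ → ℝ) (τ : ℝ) : ℝ :=
  (1 + cos τ) * (corr p p τ + corr p (deriv (deriv p)) τ - 2 * cos τ * multArea p)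

theorem continuous_croftonRemainder (hp : IsPeriodicC2 p) : Continuous (croftonRemainder p) := by
  have := continuous_corr hp.continuous hp.continuous
  have := continuous_corr hp.continuous hp.continuous_deriv2
  unfold croftonRemainder
  fun_prop

theorem integral_croftonRemainder (hp : IsPeriodicC2 p) :
    ∫ τ in (0 : ℝ)..π, croftonRemainder p τ = 2 * π ^ 2 * powerSpec p 0 - π * multArea p := by
  have hcorr := continuous_corr hp.continuous hp.continuous
  have hderiv : ∀ τ, HasDerivAt (fun τ => (1 + cos τ) * corr p (deriv p) τ + sin τ * corr p p τ
      - 2 * multArea p * (sin τ + τ / 2 + sin τ * cos τ / 2))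
      (croftonRemainder p τ - corr p p τ) τ := fun τ => by
    have hsin := hasDerivAt_sin τ
    have hcos := hasDerivAt_cos τ
    convert! (((hcos.const_add 1).mul (hp.hasDerivAt_corr_deriv τ)).add
      (hsin.mul (hp.hasDerivAt_corr_self τ))).sub (((hsin.add
      ((hasDerivAt_id τ).div_const 2)).add ((hsin.mul hcos).div_const 2)).const_mul
      (2 * multArea p)) using 1
    rw [croftonRemainder]
    linear_combination -multArea p * sin_sq_add_cos_sq τ
  have h := intervalIntegral.integral_eq_sub_of_hasDerivAt (fun τ _ => hderiv τ)
    ((hp.continuous_croftonRemainder.sub hcorr).intervalIntegrable 0 π)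
  rw [integral_sub_of_continuous hp.continuous_croftonRemainder hcorr, hp.integral_corr_self,
    hp.corr_self_deriv_zero] at h
  simp only [cos_pi, sin_pi, sin_zero, cos_zero] at h
  linarith

/-- The antiderivative that evaluates Crofton's integral. It vanishes at both ends of `(0, π)`. -/
def croftonAux (p : ℝ → ℝ) (τ : ℝ) : ℝ := 1 / 2 * gapEnergy p τ * croftonKernel τ

theorem hasDerivAt_croftonAux (hp : IsPeriodicC2 p) {τ : ℝ} (hτ : τ ∈ Ioo 0 π) :
    HasDerivAt (croftonAux p)
      (gapCorr p τ / sin τ ^ 3 * (π - τ - sin τ) - croftonRemainder p τ) τ := by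
  have hs := (sin_pos_of_mem_Ioo hτ).ne'
  have hc := (sub_pos.2 (cos_lt_one_of_mem_Ioo hτ)).ne'
  have hquot : sin τ / (1 - cos τ) = (1 + cos τ) / sin τ := by
    rw [div_eq_div_iff hc hs]
    linear_combination sin_sq_add_cos_sq τ
  convert! ((hp.hasDerivAt_gapEnergy τ).const_mul (1 / 2)).mul (hasDerivAt_croftonKernel hτ)
    using 1
  rw [hp.gapCorr_eq_sub, croftonRemainder, croftonKernel, hquot]
  field_simp
  ring

theorem gapEnergy_nonneg (p : ℝ → ℝ) (τ : ℝ) : 0 ≤ gapEnergy p τ :=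
  intervalIntegral.integral_nonneg two_pi_pos.le fun _ _ => sq_nonneg _

theorem exists_gapEnergy_le (hp : IsPeriodicC2 p) :
    ∃ C, 0 ≤ C ∧ ∀ τ, gapEnergy p τ ≤ C * (1 - cos τ) ^ 2 := by
  obtain ⟨C, -, hC⟩ := hp.exists_abs_gap_le
  have := hp.continuous
  have := hp.continuous_deriv
  refine ⟨2 * π * C ^ 2, by positivity, fun τ => ?_⟩
  calc gapEnergy p τ ≤ ∫ _ in (0 : ℝ)..2 * π, (C * (1 - cos τ)) ^ 2 :=
        intervalIntegral.integral_mono_on two_pi_pos.le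
          (Continuous.intervalIntegrable (by unfold gap; fun_prop) _ _)
          intervalIntegrable_const fun φ _ => sq_le_sq' (abs_le.1 (hC φ τ)).1 (abs_le.1 (hC φ τ)).2
    _ = 2 * π * C ^ 2 * (1 - cos τ) ^ 2 := by
        rw [intervalIntegral.integral_const, smul_eq_mul]
        ring

theorem exists_abs_croftonAux_le (hp : IsPeriodicC2 p) :
    ∃ C, ∀ τ ∈ Ioo 0 π,
      |croftonAux p τ| ≤ C * ((1 - cos τ) * ((π - τ) * (π ^ 2 / 2) + sin τ)) := by
  obtain ⟨C, hC, hle⟩ := hp.exists_gapEnergy_le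
  refine ⟨1 / 2 * C, fun τ hτ => ?_⟩
  rw [croftonAux, abs_mul, abs_of_nonneg (mul_nonneg one_half_pos.le (gapEnergy_nonneg p τ))]
  calc 1 / 2 * gapEnergy p τ * |croftonKernel τ|
      ≤ 1 / 2 * (C * (1 - cos τ) ^ 2) * |croftonKernel τ| := by
        gcongr
        exact hle τ
    _ = 1 / 2 * C * ((1 - cos τ) ^ 2 * |croftonKernel τ|) := by ring
    _ ≤ _ := mul_le_mul_of_nonneg_left (abs_croftonKernel_le hτ) (by positivity)

theorem tendsto_croftonAux (hp : IsPeriodicC2 p) {l : Filter ℝ} {a : ℝ} (hl : l ≤ 𝓝 a)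
    (hmem : Ioo 0 π ∈ l) (ha : a = 0 ∨ a = π) : Tendsto (croftonAux p) l (𝓝 0) := by
  obtain ⟨C, hC⟩ := hp.exists_abs_croftonAux_le
  refine squeeze_zero_norm' (mem_of_superset hmem hC) ?_
  have hcont : Continuous fun τ => C * ((1 - cos τ) * ((π - τ) * (π ^ 2 / 2) + sin τ)) := by
    fun_prop
  convert! (hcont.tendsto a).mono_left hl using 2
  rcases ha with rfl | rfl <;> simp

theorem integral_gapCorr_mul_sub_sin (hp : IsPeriodicC2 p) :
    ∫ τ in (0 : ℝ)..π, gapCorr p τ / sin τ ^ 3 * (π - τ - sin (π - τ)) =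
      2 * π ^ 2 * powerSpec p 0 - π * multArea p := by
  have hint := hp.intervalIntegrable_gapCorr_mul (g := fun ω => ω - sin ω) (by fun_prop)
    fun _ hω => abs_sub_sin_le hω.1.le
  have hrem := hp.continuous_croftonRemainder.intervalIntegrable (μ := volume) 0 π
  simp only [sin_pi_sub] at hint ⊢
  have h := intervalIntegral.integral_eq_sub_of_hasDerivAt_of_tendsto pi_pos
    (fun τ hτ => hp.hasDerivAt_croftonAux hτ) (hint.sub hrem)
    (hp.tendsto_croftonAux nhdsWithin_le_nhds (Ioo_mem_nhdsGT pi_pos) (.inl rfl))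
    (hp.tendsto_croftonAux nhdsWithin_le_nhds (Ioo_mem_nhdsLT pi_pos) (.inr rfl))
  rw [intervalIntegral.integral_sub hint hrem, sub_self, hp.integral_croftonRemainder] at h
  exact sub_eq_zero.1 h

end IsPeriodicC2

section Weights

/-- The weight of the `n`-th term in the Fourier expansion of `visualBound`, up to a factor
`5 π²`. The term `sin³ ω` of the integrand cancels the frequencies `±2`. -/
def visualWeight (n : ℤ) : ℝ := if n = 0 ∨ n = 2 ∨ n = -2 then 0 else n ^ 2 - 1

/-- The weight of the `n`-th term in the Fourier expansion of `hurwitzDeficit`, up to a factor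
`π²`. -/
def hurwitzWeight (n : ℤ) : ℝ := if n = 0 then 0 else (n ^ 2 - 1) * (n ^ 2 - 4)

theorem one_le_sq_of_ne_zero {n : ℤ} (hn : n ≠ 0) : (1 : ℝ) ≤ n ^ 2 := by
  exact_mod_cast Int.add_one_le_of_lt (sq_pos_of_ne_zero hn)

theorem visualWeight_nonneg (n : ℤ) : 0 ≤ visualWeight n := by
  unfold visualWeight
  split_ifs with h
  · exact le_rfl
  · exact sub_nonneg.2 (one_le_sq_of_ne_zero fun h₀ => h (.inl h₀))

theorem five_mul_visualWeight_le (n : ℤ) : 5 * visualWeight n ≤ hurwitzWeight n := by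
  by_cases h : n ∈ Finset.Icc (-2) 2
  · fin_cases h <;> norm_num [visualWeight, hurwitzWeight]
  · have hn : 3 ≤ |n| := by grind
    have h₉ : (9 : ℝ) ≤ n ^ 2 := by exact_mod_cast (by nlinarith [sq_abs n] : (9 : ℤ) ≤ n ^ 2)
    rw [visualWeight, hurwitzWeight, if_neg (by grind), if_neg (by grind)]
    nlinarith

theorem hurwitzWeight_eq_zero {n : ℤ} (h : visualWeight n = 0) : hurwitzWeight n = 0 := by
  by_cases hn : n = 0 ∨ n = 2 ∨ n = -2
  · rcases hn with rfl | rfl | rfl <;> norm_num [hurwitzWeight]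
  · rw [visualWeight, if_neg hn] at h
    rw [hurwitzWeight, h, zero_mul, ite_self]

end Weights

namespace IsStrictlyConvexC2

variable {K : Set Plane}

theorem length_sq (hK : IsStrictlyConvexC2 K) :
    length K ^ 2 = 4 * π ^ 2 * powerSpec (supportFn K) 0 := by
  rw [hK.length_eq, powerSpec_eq hK.isSupport.continuous]
  simp only [Int.cast_zero, zero_mul, cos_zero, sin_zero, mul_one, mul_zero,
    intervalIntegral.integral_zero]
  field_simp
  ring

theorem hasSum_area (hK : IsStrictlyConvexC2 K) :
    HasSum (fun n : ℤ => π * (1 - n ^ 2) * powerSpec (supportFn K) n) (area K) :=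
  hK.area_eq ▸ hasSum_multArea hK.isSupport.hasDerivAt hK.isSupport.continuous_deriv
    hK.isSupport.periodic

theorem evoluteArea_eq (hK : IsStrictlyConvexC2 K) :
    evoluteArea K = multArea (deriv (supportFn K)) := by
  have hper : Function.Periodic (fun t => deriv (supportFn K) t ^ 2 -
      deriv (deriv (supportFn K)) t ^ 2) (2 * π) := fun t => by
    simp only [periodic_deriv hK.isSupport.periodic t,
      periodic_deriv (periodic_deriv hK.isSupport.periodic) t]
  rw [evoluteArea, multArea, multArea, funext (evoluteSupport_eq K),
    ← integral_comp_add_of_periodic hper (-(π / 2))]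
  simp only [sub_eq_add_neg, deriv_comp_add_const]

theorem hasSum_evoluteArea (hK : IsStrictlyConvexC2 K) :
    HasSum (fun n : ℤ => π * (1 - n ^ 2) * (n ^ 2 * powerSpec (supportFn K) n))
      (evoluteArea K) := by
  have hp := hK.isSupport
  simpa only [hK.evoluteArea_eq, powerSpec_deriv hp.hasDerivAt hp.continuous_deriv hp.periodic]
    using hasSum_multArea hp.hasDerivAt_deriv hp.continuous_deriv2 (periodic_deriv hp.periodic)

theorem evoluteArea_nonpos (hK : IsStrictlyConvexC2 K) : evoluteArea K ≤ 0 := by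
  refine hK.hasSum_evoluteArea.nonpos fun n => ?_
  rcases eq_or_ne n 0 with rfl | hn
  · simp
  · exact mul_nonpos_of_nonpos_of_nonneg (mul_nonpos_of_nonneg_of_nonpos pi_pos.le
      (sub_nonpos.2 (one_le_sq_of_ne_zero hn)))
      (mul_nonneg (sq_nonneg _) (powerSpec_nonneg _ n))

theorem hasSum_hurwitzDeficit (hK : IsStrictlyConvexC2 K) :
    HasSum (fun n => π ^ 2 * hurwitzWeight n * powerSpec (supportFn K) n) (hurwitzDeficit K) := by
  have h := ((hK.hasSum_evoluteArea.mul_left (-π)).add (hK.hasSum_area.mul_left (4 * π))).sub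
    (hasSum_ite_eq 0 (length K ^ 2))
  have hdeficit : hurwitzDeficit K =
      -π * evoluteArea K + 4 * π * area K - length K ^ 2 := by
    rw [hurwitzDeficit, isoDeficit, abs_of_nonpos hK.evoluteArea_nonpos]
    ring
  rw [hdeficit]
  refine h.congr_fun fun n => ?_
  rw [hurwitzWeight, hK.length_sq]
  split_ifs with hn
  · subst hn
    push_cast
    ring
  · ring

theorem integrableOn_sub_sin_visualAngle (hK : IsStrictlyConvexC2 K) :
    IntegrableOn (fun P => visualAngle K P - sin (visualAngle K P)) Kᶜ :=
  (hK.integrableOn_visualAngle_iff _).2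
    (hK.isSupport.integrableOn_exteriorDensity_mul (by fun_prop)
      fun _ hω => abs_sub_sin_le hω.1.le)

theorem integrableOn_sin_cube_visualAngle (hK : IsStrictlyConvexC2 K) :
    IntegrableOn (fun P => sin (visualAngle K P) ^ 3) Kᶜ :=
  (hK.integrableOn_visualAngle_iff (sin · ^ 3)).2
    (hK.isSupport.integrableOn_exteriorDensity_mul (by fun_prop)
      fun _ hω => abs_sin_cube_le hω.1.le)

theorem integrableOn_angleIntegrand (hK : IsStrictlyConvexC2 K) :
    IntegrableOn (angleIntegrand K) Kᶜ :=
  hK.integrableOn_sub_sin_visualAngle.sub (hK.integrableOn_sin_cube_visualAngle.const_mul (2 / 3))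

theorem integral_sub_sin_visualAngle (hK : IsStrictlyConvexC2 K) :
    ∫ P in Kᶜ, (visualAngle K P - sin (visualAngle K P)) = length K ^ 2 / 2 - π * area K := by
  rw [hK.integral_visualAngle (fun ω => ω - sin ω),
    hK.isSupport.integral_exteriorDensity_mul (by fun_prop) fun _ hω => abs_sub_sin_le hω.1.le,
    hK.isSupport.integral_gapCorr_mul_sub_sin, hK.length_sq, hK.area_eq]
  ring

theorem integral_sin_cube_visualAngle (hK : IsStrictlyConvexC2 K) :
    ∫ P in Kᶜ, sin (visualAngle K P) ^ 3 =
      3 * π ^ 2 * powerSpec (supportFn K) 0 + 9 * π ^ 2 * powerSpec (supportFn K) 2 := by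
  rw [hK.integral_visualAngle (sin · ^ 3),
    hK.isSupport.integral_exteriorDensity_mul (g := (sin · ^ 3)) (by fun_prop)
      fun _ hω => abs_sin_cube_le hω.1.le,
    hK.isSupport.integral_gapCorr_mul_sin_cube]

theorem visualBound_eq (hK : IsStrictlyConvexC2 K) :
    visualBound K = 5 * (π ^ 2 * powerSpec (supportFn K) 0 - π * area K -
      6 * π ^ 2 * powerSpec (supportFn K) 2) := by
  have hsplit : ∫ P in Kᶜ, angleIntegrand K P =
      (∫ P in Kᶜ, (visualAngle K P - sin (visualAngle K P))) -
        ∫ P in Kᶜ, 2 / 3 * sin (visualAngle K P) ^ 3 :=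
    integral_sub hK.integrableOn_sub_sin_visualAngle
      (hK.integrableOn_sin_cube_visualAngle.const_mul _)
  rw [visualBound, hsplit, integral_const_mul, hK.integral_sub_sin_visualAngle,
    hK.integral_sin_cube_visualAngle, hK.length_sq]
  ring

theorem hasSum_visualBound (hK : IsStrictlyConvexC2 K) :
    HasSum (fun n => 5 * π ^ 2 * visualWeight n * powerSpec (supportFn K) n) (visualBound K) := by
  set x := powerSpec (supportFn K) with hx
  have h := (((hasSum_ite_eq 0 (π ^ 2 * x 0)).sub (hK.hasSum_area.mul_left π)).sub
    ((hasSum_ite_eq (2 : ℤ) (3 * π ^ 2 * x 2)).add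
      (hasSum_ite_eq (-2 : ℤ) (3 * π ^ 2 * x 2)))).mul_left 5
  have hbound : visualBound K = 5 * (π ^ 2 * x 0 - π * area K -
      (3 * π ^ 2 * x 2 + 3 * π ^ 2 * x 2)) := by
    rw [hK.visualBound_eq]
    ring
  rw [hbound]
  refine h.congr_fun fun n => ?_
  by_cases hn : n = 0 ∨ n = 2 ∨ n = -2
  · have hneg : x (-2) = x 2 := powerSpec_neg hK.isSupport.continuous 2
    rcases hn with rfl | rfl | rfl <;> norm_num [visualWeight, ← hx, hneg] <;> ring
  · rw [visualWeight, if_neg hn, if_neg (by grind), if_neg (by grind), if_neg (by grind)]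
    ring

theorem visualBound_nonneg (hK : IsStrictlyConvexC2 K) : 0 ≤ visualBound K :=
  hK.hasSum_visualBound.nonneg fun n =>
    mul_nonneg (mul_nonneg (by positivity) (visualWeight_nonneg n)) (powerSpec_nonneg _ n)

theorem visualBound_le_hurwitzDeficit (hK : IsStrictlyConvexC2 K) :
    visualBound K ≤ hurwitzDeficit K :=
  hasSum_le (fun n => mul_le_mul_of_nonneg_right
      (by nlinarith [five_mul_visualWeight_le n, pi_pos]) (powerSpec_nonneg _ n))
    hK.hasSum_visualBound hK.hasSum_hurwitzDeficit

theorem hurwitzDeficit_eq_zero_of_visualBound_eq_zero (hK : IsStrictlyConvexC2 K)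
    (h : visualBound K = 0) : hurwitzDeficit K = 0 := by
  have hterms := (hasSum_zero_iff_of_nonneg fun n =>
    mul_nonneg (mul_nonneg (by positivity) (visualWeight_nonneg n)) (powerSpec_nonneg _ n)).1
      (h ▸ hK.hasSum_visualBound)
  refine hK.hasSum_hurwitzDeficit.unique (hasSum_zero.congr_fun fun n => ?_)
  rcases mul_eq_zero.1 (congrFun hterms n) with hweight | hspec
  · rw [hurwitzWeight_eq_zero ((mul_eq_zero_iff_left (by positivity)).1 hweight), mul_zero,
      zero_mul]
  · rw [hspec, mul_zero]

end IsStrictlyConvexC2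

end Hurwitz

end

theorem mainTheorem1 (K : Set Hurwitz.Plane) (hK : Hurwitz.IsStrictlyConvexC2 K) :
    MeasureTheory.IntegrableOn (Hurwitz.angleIntegrand K) Kᶜ ∧
    Hurwitz.visualBound K ≤ Hurwitz.hurwitzDeficit K ∧
    (Hurwitz.hurwitzDeficit K ≠ 0 → 0 < Hurwitz.visualBound K) ∧
    (Hurwitz.hurwitzDeficit K = 0 → Hurwitz.visualBound K = 0) := by
  have hle := hK.visualBound_le_hurwitzDeficit
  have hnonneg := hK.visualBound_nonneg
  exact ⟨hK.integrableOn_angleIntegrand, hle,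
    fun hne => hnonneg.lt_of_ne' fun h => hne (hK.hurwitzDeficit_eq_zero_of_visualBound_eq_zero h),
    fun h => le_antisymm (hle.trans_eq h) hnonneg⟩
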